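/- Notation. A real is an infinite binary sequence, identified with the set of natural numbers of which it is the characteristic function. For a finite binary string $\sigma$, $[\sigma]$ is the set of reals extending $\sigma$; $\mu$ is Lebesgue measure on $2^{\omega}$, so $\mu[\sigma]=2^{-|\sigma|}$; $Z\upharpoonright n$ is the string of the first $n$ bits of $Z$; $\lambda$ is the empty string. A Martin-Löf test relative to a real $A$ is a sequence $(U_n)_{n\in\omega}$ of sets of reals that are $\Sigma^0_1$ classes relative to $A$, uniformly in $n$ (that is, there is a set $W\subseteq\omega\times 2^{<\omega}$, r.e. in $A$, with $U_n=\bigcup\{[\sigma]:(n,\sigma)\in W\}$ for all $n$), such that $\mu U_n\le 2^{-n}$ for all $n$. It is a Schnorr test relative to $A$ if moreover the numbers $\mu U_n$ are real numbers computable relative to $A$, uniformly in $n$. A real $Z$ is Martin-Löf random (respectively Schnorr random) relative to $A$ if for every Martin-Löf (respectively Schnorr) test $(U_n)$ relative to $A$ there is an $n$ with $Z\notin U_n$. The unrelativized notions are obtained by omitting the oracle. A martingale is a function $M:2^{<\omega}\to\mathbb{Q}$ with $M\ge 0$, $M(\lambda)\le 1$ and $M(\sigma 0)+M(\sigma 1)=2M(\sigma)$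 for all strings $\sigma$. A real $Z$ is computably random if there is no computable martingale $M$ with $\limsup_{n} M(Z\upharpoonright n)=\infty$. Let $\mathrm{MR}$, $\mathrm{CR}$, $\mathrm{SR}$ be the classes of Martin-Löf random, computably random and Schnorr random reals, and let $\mathrm{SR}^A$ be the class of reals that are Schnorr random relative to $A$. For $\mathcal{C}\in\{\mathrm{MR},\mathrm{CR},\mathrm{SR}\}$, $A$ is $\mathrm{Low}(\mathcal{C},\mathrm{SR})$ if $\mathcal{C}\subseteq \mathrm{SR}^A$; and $\mathrm{Low}(\mathrm{SR})$ means $\mathrm{Low}(\mathrm{SR},\mathrm{SR})$. Let $W_e$ be the $e$th r.e. set of natural numbers and $D_e$ the finite set of natural numbers with canonical index $e$. $A$ is r.e. traceable (respectively computably traceable) if there is a computable function $p:\omega\to\omega$ such that for every function $f:\omega\to\omega$ computable from $A$ there is a computable function $r:\omega\to\omega$ such that for all $x$, $|W_{r(x)}|\le p(x)$ and $f(x)\in W_{r(x)}$ (respectively $|D_{r(x)}|\le p(x)$ and $f(x)\in D_{r(x)}$). Theorem. Let $A$ be a real. (I) $A$ is $\mathrm{Low}(\mathrm{MR},\mathrm{SR})$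 if and only if $A$ is r.e. traceable. (II) $A$ is $\mathrm{Low}(\mathrm{CR},\mathrm{SR})$ if and only if $A$ is $\mathrm{Low}(\mathrm{SR})$, if and only if $A$ is computably traceable. -/

import Mathlib

namespace Lowness

open MeasureTheory Filter

/-- Reals are infinite binary sequences, i.e. points of Cantor space. -/
abbrev BinSeq : Type := ℕ → Bool

/-- Finite binary strings; the empty string is `[]` and `σ ++ [b]` is the extension of `σ` by `b`. -/
abbrev Str : Type := List Bool

/-- `restrict Z n` is the prefix `Z(0) Z(1) ⋯ Z(n-1)` of `Z`. -/
def restrict (Z : BinSeq) (n : ℕ) : Str := (List.range n).map Z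

/-- The basic clopen set of all reals that extend `σ`. -/
def basicOpen (σ : Str) : Set BinSeq := {Z | restrict Z σ.length = σ}

/-- Lebesgue measure on Cantor space: the product of the uniform measures on `{0, 1}`. -/
noncomputable def lebesgue : Measure BinSeq :=
  Measure.infinitePi fun _ : ℕ => (PMF.uniformOfFintype Bool).toMeasure

/-! ### Relative computability

A set `O` of oracles is carried along. The unrelativized notions are those for `O = ∅`, where
`RecursiveIn ∅` is `Partrec`; the notions relative to a real `A` are those for `O = {A}`. -/

/-- The characteristic function of `A`, as an oracle. -/
def toOracle (A : BinSeq) : ℕ →. ℕ := fun n => Part.some (A n).toNat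

/-- A predicate is recursively enumerable in `O` if it is the domain of a function that is partial
recursive in `O`. -/
def REPredIn {α : Type} [Primcodable α] (O : Set (ℕ →. ℕ)) (p : α → Prop) : Prop :=
  RecursiveIn O fun a => Part.assert (p a) fun _ => Part.some ()

/-- A total rational-valued function is computable in `O` if it is a quotient of integer-valued
functions computable in `O` (an integer is given as a difference of natural numbers, and the
denominator `c x + 1` is positive). -/
def RatComputableIn {α : Type} [Primcodable α] (O : Set (ℕ →. ℕ)) (f : α → ℚ) : Prop :=
  ∃ a b c : α → ℕ, ComputableIn O a ∧ ComputableIn O b ∧ ComputableIn O c ∧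
    ∀ x, f x = ((a x : ℚ) - (b x : ℚ)) / ((c x : ℚ) + 1)

/-- The sets `U n` are `Σ⁰₁` classes relative to `O`, uniformly in `n`: each is the union of the
cylinders of the strings in the `n`th section of one set that is r.e. in `O`. -/
def UniformSigma1 (O : Set (ℕ →. ℕ)) (U : ℕ → Set BinSeq) : Prop :=
  ∃ W : ℕ × Str → Prop, REPredIn O W ∧ ∀ n, U n = {Z | ∃ σ, W (n, σ) ∧ Z ∈ basicOpen σ}

/-- The real numbers `x n` are computable relative to `O`, uniformly in `n`. -/
def UniformComputableReal (O : Set (ℕ →. ℕ)) (x : ℕ → ℝ) : Prop :=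
  ∃ q : ℕ × ℕ → ℚ, RatComputableIn O q ∧ ∀ n k, |x n - (q (n, k) : ℝ)| ≤ (1 / 2 : ℝ) ^ k

/-! ### Randomness notions relative to `O` -/

/-- Martin-Löf tests relative to `O`. -/
def IsMLTest (O : Set (ℕ →. ℕ)) (U : ℕ → Set BinSeq) : Prop :=
  UniformSigma1 O U ∧ ∀ n, lebesgue.real (U n) ≤ (1 / 2 : ℝ) ^ n

/-- Schnorr tests relative to `O`. -/
def IsSchnorrTest (O : Set (ℕ →. ℕ)) (U : ℕ → Set BinSeq) : Prop :=
  IsMLTest O U ∧ UniformComputableReal O fun n => lebesgue.real (U n)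

/-- The reals that are Martin-Löf random relative to `O`. -/
def MR (O : Set (ℕ →. ℕ)) : Set BinSeq :=
  {Z | ∀ U, IsMLTest O U → ∃ n, Z ∉ U n}

/-- The reals that are Schnorr random relative to `O`. -/
def SR (O : Set (ℕ →. ℕ)) : Set BinSeq :=
  {Z | ∀ U, IsSchnorrTest O U → ∃ n, Z ∉ U n}

/-- (Total) martingales, i.e. betting strategies: rational-valued, with nonnegative capital,
initial capital at most `1`, and the fairness condition. -/
structure IsMartingale (M : Str → ℚ) : Prop where
  nonneg : ∀ σ, 0 ≤ M σ
  init_le : M [] ≤ 1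
  fair : ∀ σ, M (σ ++ [false]) + M (σ ++ [true]) = 2 * M σ

/-- `M` succeeds on `Z`: `limsup M(Z ↾ n) = ∞`, that is, every bound is exceeded infinitely
often. -/
def Succeeds (M : Str → ℚ) (Z : BinSeq) : Prop :=
  ∀ c : ℚ, ∃ᶠ n in atTop, c < M (restrict Z n)

/-- The reals that are computably random relative to `O`. -/
def CR (O : Set (ℕ →. ℕ)) : Set BinSeq :=
  {Z | ∀ M, IsMartingale M → RatComputableIn O M → ¬ Succeeds M Z}

/-- `A ∈ Low(C, D)`: every member of `C` is a member of `D` relative to `A`. -/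
def Low (C D : Set (ℕ →. ℕ) → Set BinSeq) : Set BinSeq :=
  {A | C ∅ ⊆ D {toOracle A}}

/-! ### Traceability -/

/-- The `e`th r.e. set of natural numbers: the domain of the `e`th partial recursive function. -/
def W (e : ℕ) : Set ℕ :=
  {y | (Nat.Partrec.Code.eval (Denumerable.ofNat Nat.Partrec.Code e) y).Dom}

/-- The finite set with canonical index `e`: the set of positions of the ones in the binary
expansion of `e`. -/
def D (e : ℕ) : Finset ℕ := e.bitIndices.toFinset

/-- `A` is r.e. traceable. -/
def RETraceable (A : BinSeq) : Prop :=
  ∃ p : ℕ → ℕ, Computable p ∧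
    ∀ f : ℕ → ℕ, ComputableIn {toOracle A} f →
      ∃ r : ℕ → ℕ, Computable r ∧ ∀ x, (W (r x)).encard ≤ p x ∧ f x ∈ W (r x)

/-- `A` is computably traceable. -/
def ComputablyTraceable (A : BinSeq) : Prop :=
  ∃ p : ℕ → ℕ, Computable p ∧
    ∀ f : ℕ → ℕ, ComputableIn {toOracle A} f →
      ∃ r : ℕ → ℕ, Computable r ∧ ∀ x, (D (r x)).card ≤ p x ∧ f x ∈ D (r x)

end Lowness

namespace Lowness

open MeasureTheory Filter Encodable

/-! ### Computability relative to an oracle -/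

section Oracle

variable {α β γ δ : Type} [Primcodable α] [Primcodable β] [Primcodable γ] [Primcodable δ]
variable {O : Set (ℕ →. ℕ)}

/-! A real fails to be Schnorr random relative to `A` exactly when it lies in infinitely many sets
of some `A`-computable sequence of clopen sets with measures as small as prescribed
(`notMem_SR_of_clopen`, `exists_clopen_of_notMem_SR`). Such a sequence is a function from numbers to
codes of finite sets of strings, so traces apply. Replacing each code by the whole trace, with the
clopen sets chosen small enough to pay for the number of its members, removes the oracle. An r.e.
trace gives a Martin-Löf test (`low_MR_SR_of_reTraceable`) and a computable trace a Schnorr test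
(`low_SR_SR_of_computablyTraceable`).

Conversely, an `A`-computable `f` is encoded by the sets `block k (f k)` of measure `2⁻ᵏ`, where
blocks with the same `k` are independent. If `A` is low for the pair MR, SR, every real in
infinitely many of them lies in a fixed `Σ⁰₁` class of measure at most `1 / 2` containing all
non-random reals (`exists_universal`). A category argument (`exists_avoiding`) gives a cylinder in
which the complement of that class is nonnull and misses `block k (f k)` up to a null set for all
large `k`. By independence few blocks can almost miss a nonnull set (`card_le_of_almost_avoiding`),
and almost missing it is recognizable at a finite stage; the indices so recognized form the trace.

For the pair CR, SR the inclusions MR ⊆ CR ⊆ SR reduce everything to turning the r.e. trace into a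
computable one. This is possible when every `A`-computable function is computably bounded. If some
`g` computable from `A` is not, a real is built that follows strategies defeating more and more
computable martingales (`exists_CR_notMem_SR`). Infinitely often `g n` is a sufficient time bound
for evaluating the current strategy, so `A` can cover the real by a few guesses and it is not
Schnorr random relative to `A`. -/

theorem recursiveIn_comp {f : β →. γ} {g : α → β} (hf : RecursiveIn O f) (hg : ComputableIn O g) :
    RecursiveIn O fun a => f (g a) :=
  (Nat.RecursiveIn.comp hf hg).of_eq fun n => by
    simp only [Part.map_some, Part.bind_eq_bind]
    rcases e : decode (α := α) n with - | a <;> simp [encodek]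

theorem computableIn_comp {f : β → γ} {g : α → β} (hf : ComputableIn O f) (hg : ComputableIn O g) :
    ComputableIn O fun a => f (g a) :=
  recursiveIn_comp (f := fun b => Part.some (f b)) hf hg

theorem computableIn_pair {f : α → β} {g : α → γ} (hf : ComputableIn O f) (hg : ComputableIn O g) :
    ComputableIn O fun a => (f a, g a) :=
  (Nat.RecursiveIn.pair hf hg).of_eq fun n => by cases decode (α := α) n <;> simp [Seq.seq]

theorem nat_recursiveIn_some : Nat.RecursiveIn O Part.some := Nat.Partrec.some.recursiveIn

theorem recursiveIn_bind {f : α →. β} {g : α × β →. γ} (hf : RecursiveIn O f)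
    (hg : RecursiveIn O g) : RecursiveIn O fun a => (f a).bind fun b => g (a, b) :=
  (Nat.RecursiveIn.comp hg (Nat.RecursiveIn.pair nat_recursiveIn_some hf)).of_eq fun n => by
    rcases e : decode (α := α) n <;> simp [Seq.seq, e, encodek]

theorem recursiveIn_map {f : α →. β} {g : α × β → γ} (hf : RecursiveIn O f)
    (hg : ComputableIn O g) : RecursiveIn O fun a => (f a).map fun b => g (a, b) := by
  simpa [Part.bind_some_eq_map] using recursiveIn_bind (g := fun p => Part.some (g p)) hf hg

theorem recursiveIn_nat_rec {f : α → ℕ} {g : α →. β} {h : α × ℕ × β →. β} (hf : ComputableIn O f)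
    (hg : RecursiveIn O g) (hh : RecursiveIn O h) :
    RecursiveIn O fun a => (f a).rec (g a) fun y IH => IH.bind fun i => h (a, y, i) :=
  (Nat.RecursiveIn.comp (Nat.RecursiveIn.prec hg hh)
    (Nat.RecursiveIn.pair nat_recursiveIn_some hf)).of_eq fun n => by
    rcases e : decode (α := α) n with - | a
    · simp [Seq.seq]
    · simp [Seq.seq]
      induction f a <;> simp_all

theorem computableIn_nat_rec {f : α → ℕ} {g : α → β} {h : α → ℕ → β → β} (hf : ComputableIn O f)
    (hg : ComputableIn O g) (hh : ComputableIn O fun p : α × ℕ × β => h p.1 p.2.1 p.2.2) :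
    ComputableIn O fun a => Nat.rec (motive := fun _ => β) (g a) (h a) (f a) :=
  (recursiveIn_nat_rec hf hg hh).of_eq fun a => by
    change _ = Part.some (Nat.rec (motive := fun _ => β) (g a) (h a) (f a))
    generalize f a = n
    induction n with
    | zero => rfl
    | succ n ih => simp only [ih, Part.bind_some]

theorem recursiveIn_rfind {p : α × ℕ →. Bool} (hp : RecursiveIn O p) :
    RecursiveIn O fun a => Nat.rfind fun n => p (a, n) :=
  (Nat.RecursiveIn.rfind <| recursiveIn_map (g := fun q : (α × ℕ) × Bool => cond q.2 0 1) hp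
        ((Primrec.dom_bool fun b => cond b 0 1).comp Primrec.snd).computableIn).of_eq
    fun n => by
    rcases e : decode (α := α) n with - | a
    · simp only [Part.coe_none, Part.bind_none]
      exact Nat.rfind_zero_none _ (by simp [e])
    · simp [e, Part.map_map, Part.map_id']

attribute [fun_prop] ComputableIn

@[fun_prop]
theorem computableIn_id : ComputableIn O fun a : α => a := ComputableIn.id
@[fun_prop]
theorem computableIn_const (b : β) : ComputableIn O fun _ : α => b := ComputableIn.const b
attribute [fun_prop] computableIn_comp computableIn_pair
@[fun_prop]
theorem computableIn_fst {f : α → β × γ} (hf : ComputableIn O f) : ComputableIn O fun a => (f a).1 :=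
  computableIn_comp ComputableIn.fst hf
@[fun_prop]
theorem computableIn_snd {f : α → β × γ} (hf : ComputableIn O f) : ComputableIn O fun a => (f a).2 :=
  computableIn_comp ComputableIn.snd hf

theorem computableIn_of_primrec₂ {f : β → γ → δ} (hf : Primrec₂ f) {g : α → β} {h : α → γ}
    (hg : ComputableIn O g) (hh : ComputableIn O h) : ComputableIn O fun a => f (g a) (h a) :=
  computableIn_comp (Primrec.computableIn hf) (computableIn_pair hg hh)

attribute [fun_prop] computableIn_nat_rec

theorem computableIn_of_primrec {f : β → γ} (hf : Primrec f) {g : α → β}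
    (hg : ComputableIn O g) : ComputableIn O fun a => f (g a) :=
  computableIn_comp hf.computableIn hg

@[fun_prop]
theorem computableIn_add {f : α → ℕ} {g : α → ℕ} (hf : ComputableIn O f)
    (hg : ComputableIn O g) : ComputableIn O fun a => f a + g a :=
  computableIn_of_primrec₂ Primrec.nat_add hf hg

@[fun_prop]
theorem computableIn_sub {f : α → ℕ} {g : α → ℕ} (hf : ComputableIn O f)
    (hg : ComputableIn O g) : ComputableIn O fun a => f a - g a :=
  computableIn_of_primrec₂ Primrec.nat_sub hf hg

@[fun_prop]
theorem computableIn_mul {f : α → ℕ} {g : α → ℕ} (hf : ComputableIn O f)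
    (hg : ComputableIn O g) : ComputableIn O fun a => f a * g a :=
  computableIn_of_primrec₂ Primrec.nat_mul hf hg

@[fun_prop]
theorem computableIn_div {f : α → ℕ} {g : α → ℕ} (hf : ComputableIn O f)
    (hg : ComputableIn O g) : ComputableIn O fun a => f a / g a :=
  computableIn_of_primrec₂ Primrec.nat_div hf hg

@[fun_prop]
theorem computableIn_mod {f : α → ℕ} {g : α → ℕ} (hf : ComputableIn O f)
    (hg : ComputableIn O g) : ComputableIn O fun a => f a % g a :=
  computableIn_of_primrec₂ Primrec.nat_mod hf hg

@[fun_prop]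
theorem computableIn_pow {f : α → ℕ} {g : α → ℕ} (hf : ComputableIn O f)
    (hg : ComputableIn O g) : ComputableIn O fun a => f a ^ g a :=
  computableIn_of_primrec₂ (Primrec₂.unpaired'.1 Nat.Primrec.pow) hf hg

@[fun_prop]
theorem computableIn_natPair {f : α → ℕ} {g : α → ℕ} (hf : ComputableIn O f)
    (hg : ComputableIn O g) : ComputableIn O fun a => Nat.pair (f a) (g a) :=
  computableIn_of_primrec₂ Primrec₂.natPair hf hg

@[fun_prop]
theorem computableIn_unpair {f : α → ℕ} (hf : ComputableIn O f) :
    ComputableIn O fun a => Nat.unpair (f a) :=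
  computableIn_of_primrec Primrec.unpair hf

@[fun_prop]
theorem computableIn_succ {f : α → ℕ} (hf : ComputableIn O f) :
    ComputableIn O fun a => Nat.succ (f a) :=
  computableIn_of_primrec Primrec.succ hf

@[fun_prop]
theorem computableIn_decide_le {f : α → ℕ} {g : α → ℕ} (hf : ComputableIn O f)
    (hg : ComputableIn O g) : ComputableIn O fun a => decide (f a ≤ g a) :=
  computableIn_of_primrec₂ Primrec.nat_le.decide hf hg

@[fun_prop]
theorem computableIn_decide_lt {f : α → ℕ} {g : α → ℕ} (hf : ComputableIn O f)
    (hg : ComputableIn O g) : ComputableIn O fun a => decide (f a < g a) :=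
  computableIn_of_primrec₂ Primrec.nat_lt.decide hf hg

@[fun_prop]
theorem computableIn_decide_eq [DecidableEq β] {f g : α → β} (hf : ComputableIn O f)
    (hg : ComputableIn O g) : ComputableIn O fun a => decide (f a = g a) :=
  computableIn_of_primrec₂ Primrec.eq.decide hf hg

@[fun_prop]
theorem computableIn_and {f : α → Bool} {g : α → Bool} (hf : ComputableIn O f)
    (hg : ComputableIn O g) : ComputableIn O fun a => (f a && g a) :=
  computableIn_of_primrec₂ Primrec.and hf hg

@[fun_prop]
theorem computableIn_or {f : α → Bool} {g : α → Bool} (hf : ComputableIn O f)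
    (hg : ComputableIn O g) : ComputableIn O fun a => (f a || g a) :=
  computableIn_of_primrec₂ Primrec.or hf hg

@[fun_prop]
theorem computableIn_not {f : α → Bool} (hf : ComputableIn O f) :
    ComputableIn O fun a => (!f a) :=
  computableIn_of_primrec Primrec.not hf

@[fun_prop]
theorem computableIn_cond {c : α → Bool} {f g : α → β} (hc : ComputableIn O c)
    (hf : ComputableIn O f) (hg : ComputableIn O g) :
    ComputableIn O fun a => bif c a then f a else g a :=
  computableIn_of_primrec (f := fun p : Bool × β × β => bif p.1 then p.2.1 else p.2.2)
    (Primrec.cond Primrec.fst (Primrec.fst.comp Primrec.snd) (Primrec.snd.comp Primrec.snd))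
    (g := fun a => (c a, f a, g a)) (by fun_prop)

@[fun_prop]
theorem computableIn_boolToNat {f : α → Bool} (hf : ComputableIn O f) :
    ComputableIn O fun a => Bool.toNat (f a) :=
  computableIn_of_primrec (Primrec.dom_bool _) hf

@[fun_prop]
theorem computableIn_encode {f : α → β} (hf : ComputableIn O f) :
    ComputableIn O fun a => encode (f a) :=
  computableIn_of_primrec Primrec.encode hf

@[fun_prop]
theorem computableIn_decode {f : α → ℕ} (hf : ComputableIn O f) :
    ComputableIn O fun a => (decode (f a) : Option β) :=
  computableIn_of_primrec Primrec.decode hf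

@[fun_prop]
theorem computableIn_ofNat {β : Type} [Denumerable β] {f : α → ℕ} (hf : ComputableIn O f) :
    ComputableIn O fun a => Denumerable.ofNat β (f a) :=
  computableIn_of_primrec (Primrec.ofNat β) hf

@[fun_prop]
theorem computableIn_some {f : α → β} (hf : ComputableIn O f) :
    ComputableIn O fun a => some (f a) :=
  computableIn_of_primrec Primrec.option_some hf

@[fun_prop]
theorem computableIn_isSome {f : α → Option β} (hf : ComputableIn O f) :
    ComputableIn O fun a => Option.isSome (f a) :=
  computableIn_of_primrec Primrec.option_isSome hf

@[fun_prop]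
theorem computableIn_getD {f : α → Option β} {g : α → β} (hf : ComputableIn O f)
    (hg : ComputableIn O g) : ComputableIn O fun a => Option.getD (f a) (g a) :=
  computableIn_of_primrec₂ Primrec.option_getD hf hg

@[fun_prop]
theorem computableIn_cons {f : α → β} {g : α → List β} (hf : ComputableIn O f)
    (hg : ComputableIn O g) : ComputableIn O fun a => (f a :: g a) :=
  computableIn_of_primrec₂ Primrec.list_cons hf hg

@[fun_prop]
theorem computableIn_append {f : α → List β} {g : α → List β} (hf : ComputableIn O f)
    (hg : ComputableIn O g) : ComputableIn O fun a => f a ++ g a :=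
  computableIn_of_primrec₂ Primrec.list_append hf hg

@[fun_prop]
theorem computableIn_length {f : α → List β} (hf : ComputableIn O f) :
    ComputableIn O fun a => List.length (f a) :=
  computableIn_of_primrec Primrec.list_length hf

@[fun_prop]
theorem computableIn_range {f : α → ℕ} (hf : ComputableIn O f) :
    ComputableIn O fun a => List.range (f a) :=
  computableIn_of_primrec Primrec.list_range hf

@[fun_prop]
theorem computableIn_flatten {f : α → List (List β)} (hf : ComputableIn O f) :
    ComputableIn O fun a => List.flatten (f a) :=
  computableIn_of_primrec Primrec.list_flatten hf

@[fun_prop]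
theorem computableIn_take {f : α → ℕ} {g : α → List β} (hf : ComputableIn O f)
    (hg : ComputableIn O g) : ComputableIn O fun a => List.take (f a) (g a) :=
  computableIn_of_primrec₂ Primrec.list_take hf hg

@[fun_prop]
theorem computableIn_toList {f : α → Option β} (hf : ComputableIn O f) :
    ComputableIn O fun a => Option.toList (f a) :=
  computableIn_of_primrec Primrec.optionToList hf

@[fun_prop]
theorem computableIn_getElem? {f : α → List β} {g : α → ℕ} (hf : ComputableIn O f)
    (hg : ComputableIn O g) : ComputableIn O fun a => (f a)[g a]? :=
  computableIn_of_primrec₂ Primrec.list_getElem? hf hg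

@[fun_prop]
theorem computableIn_evaln {k : α → ℕ} {c : α → Nat.Partrec.Code} {n : α → ℕ}
    (hk : ComputableIn O k) (hc : ComputableIn O c) (hn : ComputableIn O n) :
    ComputableIn O fun a => Nat.Partrec.Code.evaln (k a) (c a) (n a) :=
  computableIn_of_primrec Nat.Partrec.Code.primrec_evaln (g := fun a => ((k a, c a), n a))
    (by fun_prop)

theorem computableIn_find {P : α → ℕ → Bool} (hP : ComputableIn O fun p : α × ℕ => P p.1 p.2)
    (hex : ∀ a, ∃ n, P a n = true) : ComputableIn O fun a => Nat.find (hex a) :=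
  (recursiveIn_rfind (p := fun p => Part.some (P p.1 p.2)) hP).of_eq fun a => by
    refine Part.eq_some_iff.2 (Nat.mem_rfind.2 ⟨?_, fun {m} hm => ?_⟩)
    · simpa using (Nat.find_spec (hex a)).symm
    · simpa using Nat.find_min (hex a) hm

@[fun_prop]
theorem computableIn_option_bind {o : α → Option β} {f : α → β → Option γ} (ho : ComputableIn O o)
    (hf : ComputableIn O fun p : α × β => f p.1 p.2) :
    ComputableIn O fun a => (o a).bind (f a) := by
  have h₁ : RecursiveIn O fun a => (o a : Part β) :=
    recursiveIn_comp (f := fun o : Option β => (o : Part β))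
      (Computable.ofOption Computable.id).recursiveIn ho
  have h₂ : RecursiveIn O fun a => (o a : Part β).bind fun b => Part.some (f a b) :=
    recursiveIn_bind (g := fun p : α × β => Part.some (f p.1 p.2)) h₁ hf
  -- The recursion runs once if `o a` has a value and not at all otherwise, so the partial bind is
  -- never evaluated where it would diverge.
  have h₃ := recursiveIn_nat_rec (f := fun a => (o a).isSome.toNat)
    (g := fun _ : α => Part.some (none : Option γ))
    (h := fun p : α × ℕ × Option γ => (o p.1 : Part β).bind fun b => Part.some (f p.1 b))
    (by fun_prop) (ComputableIn.const none) (recursiveIn_comp h₂ ComputableIn.fst)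
  refine h₃.of_eq fun a => ?_
  cases h : o a <;> simp [h]

@[fun_prop]
theorem computableIn_option_map {o : α → Option β} {f : α → β → γ} (ho : ComputableIn O o)
    (hf : ComputableIn O fun p : α × β => f p.1 p.2) :
    ComputableIn O fun a => (o a).map (f a) := by
  simp only [Option.map_eq_bind, Function.comp_def]
  fun_prop

@[fun_prop]
theorem computableIn_foldl {l : α → List β} {h : α → γ → β → γ} {g : α → γ}
    (hh : ComputableIn O fun p : α × γ × β => h p.1 p.2.1 p.2.2) (hg : ComputableIn O g)
    (hl : ComputableIn O l) : ComputableIn O fun a => (l a).foldl (h a) (g a) := by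
  -- The indices used stay below the length of the list, so the default `s` is never taken.
  have H : ComputableIn O fun a => Nat.rec (motive := fun _ => γ) (g a)
      (fun i s => (((l a)[i]?).map fun b => h a s b).getD s) (l a).length := by
    fun_prop
  refine H.of_eq fun a => congrArg Part.some ?_
  have key : ∀ n, Nat.rec (motive := fun _ => γ) (g a)
      (fun i s => (((l a)[i]?).map fun b => h a s b).getD s) n
      = ((l a).take n).foldl (h a) (g a) := by
    intro n
    induction n with
    | zero => simp
    | succ n ih =>
      simp only [ih, List.take_add_one, List.foldl_append]
      cases (l a)[n]? <;> simp
  simp [key]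

@[fun_prop]
theorem computableIn_flatMap {l : α → List β} {f : α → β → List γ} (hl : ComputableIn O l)
    (hf : ComputableIn O fun p : α × β => f p.1 p.2) :
    ComputableIn O fun a => (l a).flatMap (f a) := by
  have H : ComputableIn O fun a => (l a).foldl (fun s b => s ++ f a b) [] := by fun_prop
  refine H.of_eq fun a => congrArg Part.some ?_
  have key : ∀ (m : List β) (s : List γ), m.foldl (fun s b => s ++ f a b) s = s ++ m.flatMap (f a) := by
    intro m
    induction m with
    | nil => simp
    | cons b m ih => intro s; simp [ih]
  simpa using key (l a) []

@[fun_prop]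
theorem computableIn_map {l : α → List β} {f : α → β → γ} (hl : ComputableIn O l)
    (hf : ComputableIn O fun p : α × β => f p.1 p.2) :
    ComputableIn O fun a => (l a).map (f a) := by
  have H : ComputableIn O fun a => (l a).flatMap fun b => [f a b] := by fun_prop
  exact H.of_eq fun a => congrArg Part.some List.map_eq_flatMap.symm

@[fun_prop]
theorem computableIn_filter {l : α → List β} {f : α → β → Bool} (hl : ComputableIn O l)
    (hf : ComputableIn O fun p : α × β => f p.1 p.2) :
    ComputableIn O fun a => (l a).filter (f a) := by
  have H : ComputableIn O fun a => (l a).flatMap fun b => bif f a b then [b] else [] := by fun_prop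
  refine H.of_eq fun a => congrArg Part.some ?_
  beta_reduce
  induction l a with
  | nil => rfl
  | cons b m ih => cases h : f a b <;> simp_all

@[fun_prop]
theorem computableIn_any {l : α → List β} {f : α → β → Bool} (hl : ComputableIn O l)
    (hf : ComputableIn O fun p : α × β => f p.1 p.2) :
    ComputableIn O fun a => (l a).any (f a) := by
  have H : ComputableIn O fun a => decide (0 < ((l a).filter (f a)).length) := by fun_prop
  refine H.of_eq fun a => congrArg Part.some ?_
  rw [Bool.eq_iff_iff]
  simp [List.length_pos_iff_exists_mem]

@[fun_prop]
theorem computableIn_all {l : α → List β} {f : α → β → Bool} (hl : ComputableIn O l)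
    (hf : ComputableIn O fun p : α × β => f p.1 p.2) :
    ComputableIn O fun a => (l a).all (f a) := by
  have H : ComputableIn O fun a => !(l a).any fun b => !f a b := by fun_prop
  exact H.of_eq fun a => congrArg Part.some (by simp [List.not_any_eq_all_not])

end Oracle

/-! ### Stage approximations of oracle computations -/

theorem computableIn_empty_iff {α β : Type} [Primcodable α] [Primcodable β] {f : α → β} :
    ComputableIn ∅ f ↔ Computable f :=
  recursiveIn_empty_iff

/-- All members of `O` are total functions. -/
def TotalOracles (O : Set (ℕ →. ℕ)) : Prop := ∀ g ∈ O, ∃ h : ℕ → ℕ, g = fun n => Part.some (h n)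

theorem totalOracles_empty : TotalOracles ∅ := by simp [TotalOracles]

theorem totalOracles_singleton (A : BinSeq) : TotalOracles {toOracle A} := by
  rintro g rfl
  exact ⟨fun n => (A n).toNat, rfl⟩

/-- Since `q` holds of at most one number, the head of the filtered list is that number as soon as
the range reaches it. This turns an unbounded search into a monotone family of bounded ones. -/
theorem getElem?_zero_filter_range {q : ℕ → Bool} (hq : ∀ m n, q m = true → q n = true → m = n)
    (s n : ℕ) : ((List.range s).filter q)[0]? = some n ↔ n < s ∧ q n = true := by
  have hmem : ∀ m, m ∈ (List.range s).filter q ↔ m < s ∧ q m = true := by simp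
  rw [← hmem]
  refine ⟨fun h => List.mem_of_getElem? h, fun h => ?_⟩
  have hpos := List.length_pos_of_mem h
  rw [List.getElem?_eq_getElem hpos, Option.some_inj]
  exact hq _ _ ((hmem _).1 (List.getElem_mem hpos)).2 ((hmem _).1 h).2

/-- A partial function recursive in total oracles is the limit of monotone computable stages. -/
theorem exists_stages {O : Set (ℕ →. ℕ)} (hO : TotalOracles O) {f : ℕ →. ℕ}
    (hf : Nat.RecursiveIn O f) :
    ∃ F : ℕ → ℕ → Option ℕ, (ComputableIn O fun p : ℕ × ℕ => F p.1 p.2) ∧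
      (∀ s t x y, s ≤ t → F s x = some y → F t x = some y) ∧
      ∀ x y, y ∈ f x ↔ ∃ s, F s x = some y := by
  have total : ∀ g : ℕ → ℕ, ComputableIn O g →
      ∃ F : ℕ → ℕ → Option ℕ, (ComputableIn O fun p : ℕ × ℕ => F p.1 p.2) ∧
        (∀ s t x y, s ≤ t → F s x = some y → F t x = some y) ∧
        ∀ x y, y ∈ Part.some (g x) ↔ ∃ s, F s x = some y := fun g hg =>
    ⟨fun _ x => some (g x), by fun_prop, by simp, by simp [eq_comm]⟩
  induction hf with
  | zero => exact total (fun _ => 0) (by fun_prop)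
  | succ => exact total Nat.succ (by fun_prop)
  | left => exact total (fun n => n.unpair.1) (by fun_prop)
  | right => exact total (fun n => n.unpair.2) (by fun_prop)
  | oracle g hg =>
    obtain ⟨h, rfl⟩ := hO g hg
    exact total h (RecursiveIn.oracle _ hg)
  | @pair f g _ _ ihf ihg =>
    obtain ⟨F, hF, mF, eF⟩ := ihf
    obtain ⟨G, hG, mG, eG⟩ := ihg
    refine ⟨fun s x => (F s x).bind fun a => (G s x).map fun b => Nat.pair a b, by fun_prop, ?_, ?_⟩
    · intro s t x y hst h
      simp only [Option.bind_eq_some_iff, Option.map_eq_some_iff] at h ⊢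
      obtain ⟨a, ha, b, hb, rfl⟩ := h
      exact ⟨a, mF _ _ _ _ hst ha, b, mG _ _ _ _ hst hb, rfl⟩
    · intro x y
      simp only [Seq.seq, Part.map_eq_map, Part.mem_bind_iff, Part.mem_map_iff, eF, eG,
        Option.bind_eq_some_iff, Option.map_eq_some_iff]
      constructor
      · rintro ⟨_, ⟨a, ⟨s, hs⟩, rfl⟩, b, ⟨t, ht⟩, rfl⟩
        exact ⟨max s t, a, mF _ _ _ _ (le_max_left _ _) hs, b, mG _ _ _ _ (le_max_right _ _) ht, rfl⟩
      · rintro ⟨s, a, ha, b, hb, rfl⟩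
        exact ⟨_, ⟨a, ⟨s, ha⟩, rfl⟩, b, ⟨s, hb⟩, rfl⟩
  | @comp f g _ _ ihf ihg =>
    obtain ⟨F, hF, mF, eF⟩ := ihf
    obtain ⟨G, hG, mG, eG⟩ := ihg
    refine ⟨fun s x => (G s x).bind fun a => F s a, by fun_prop, ?_, ?_⟩
    · intro s t x y hst h
      simp only [Option.bind_eq_some_iff] at h ⊢
      obtain ⟨a, ha, hb⟩ := h
      exact ⟨a, mG _ _ _ _ hst ha, mF _ _ _ _ hst hb⟩
    · intro x y
      refine (Part.mem_bind_iff (f := g x) (g := f)).trans ?_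
      simp only [eF, eG, Option.bind_eq_some_iff]
      constructor
      · rintro ⟨a, ⟨s, hs⟩, t, ht⟩
        exact ⟨max s t, a, mG _ _ _ _ (le_max_left _ _) hs, mF _ _ _ _ (le_max_right _ _) ht⟩
      · rintro ⟨s, a, ha, hb⟩
        exact ⟨a, ⟨s, ha⟩, s, hb⟩
  | @prec f g _ _ ihf ihg =>
    obtain ⟨F, hF, mF, eF⟩ := ihf
    obtain ⟨G, hG, mG, eG⟩ := ihg
    let R : ℕ → ℕ → ℕ → Option ℕ := fun s a n => Nat.rec (motive := fun _ => Option ℕ) (F s a)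
      (fun y IH => IH.bind fun i => G s (Nat.pair a (Nat.pair y i))) n
    have mR : ∀ s t a n y, s ≤ t → R s a n = some y → R t a n = some y := by
      intro s t a n y hst
      induction n generalizing y with
      | zero => exact mF _ _ _ _ hst
      | succ n ih =>
        simp only [R, Option.bind_eq_some_iff] at ih ⊢
        rintro ⟨i, hi, h⟩
        exact ⟨i, ih i hi, mG _ _ _ _ hst h⟩
    refine ⟨fun s p => R s p.unpair.1 p.unpair.2, by fun_prop, fun s t x y => mR _ _ _ _ _, ?_⟩
    intro x y
    simp only
    generalize x.unpair.1 = a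
    generalize x.unpair.2 = n
    induction n generalizing y with
    | zero => exact eF _ _
    | succ n ih =>
      simp only [Part.bind_eq_bind, Part.mem_bind_iff, eG] at ih ⊢
      simp only [ih]
      constructor
      · rintro ⟨i, ⟨s, hs⟩, t, ht⟩
        refine ⟨max s t, Option.bind_eq_some_iff.2 ⟨i, mR _ _ _ _ _ (le_max_left _ _) hs, mG _ _ _ _ (le_max_right _ _) ht⟩⟩
      · rintro ⟨s, hs⟩
        obtain ⟨i, hi, h⟩ := Option.bind_eq_some_iff.1 hs
        exact ⟨i, ⟨s, hi⟩, s, h⟩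
  | @rfind f _ ihf =>
    obtain ⟨F, hF, mF, eF⟩ := ihf
    -- `n` is accepted when its value is already seen to be zero and all smaller arguments are
    -- already seen to have positive values. The default `0` makes a value that is still undefined
    -- fail the positivity test.
    let q : ℕ → ℕ → ℕ → Bool := fun s a n => decide (F s (Nat.pair a n) = some 0) &&
      (List.range n).all fun m => decide (0 < (F s (Nat.pair a m)).getD 0)
    have hq : ∀ s a n, q s a n = true ↔ F s (Nat.pair a n) = some 0 ∧
        ∀ m < n, ∃ k, F s (Nat.pair a m) = some (k + 1) := by
      intro s a n
      simp only [q, Bool.and_eq_true, decide_eq_true_eq, List.all_eq_true, List.mem_range]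
      refine and_congr_right fun _ => forall₂_congr fun m _ => ?_
      rcases F s (Nat.pair a m) with _ | _ | k <;> simp
    have hu : ∀ s a m n, q s a m = true → q s a n = true → m = n := by
      intro s a m n hm hn
      rw [hq] at hm hn
      rcases lt_trichotomy m n with h | h | h
      · obtain ⟨k, hk⟩ := hn.2 m h; simp [hk] at hm
      · exact h
      · obtain ⟨k, hk⟩ := hm.2 n h; simp [hk] at hn
    refine ⟨fun s a => ((List.range s).filter (q s a))[0]?, by fun_prop, ?_, ?_⟩
    · intro s t a n hst
      simp only [getElem?_zero_filter_range (hu _ _), hq]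
      rintro ⟨h1, h2, h3⟩
      exact ⟨h1.trans_le hst, mF _ _ _ _ hst h2, fun m hm =>
        (h3 m hm).imp fun k hk => mF _ _ _ _ hst hk⟩
    · intro a n
      refine Nat.mem_rfind.trans ?_
      simp only [getElem?_zero_filter_range (hu _ _), hq, Part.map_eq_map, Part.mem_map_iff, eF]
      constructor
      · rintro ⟨⟨x, ⟨s, hs⟩, hx⟩, h⟩
        have h' : ∀ m, ∃ s, m < n → ∃ k, F s (Nat.pair a m) = some (k + 1) := by
          intro m
          by_cases hm : m < n
          · obtain ⟨y, ⟨t, ht⟩, hy⟩ := h hm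
            obtain ⟨k, rfl⟩ := Nat.exists_eq_succ_of_ne_zero (by simpa using hy)
            exact ⟨t, fun _ => ⟨k, ht⟩⟩
          · exact ⟨0, fun h => absurd h hm⟩
        choose t ht using h'
        have hx0 : x = 0 := by simpa using hx
        -- The sum dominates each of the finitely many stages `t m`; the term `n + 1` puts `n`
        -- inside the search range.
        refine ⟨n + 1 + s + ∑ m ∈ Finset.range n, t m, by omega,
          mF _ _ _ _ (by omega) (hx0 ▸ hs), fun m hm => ?_⟩
        obtain ⟨k, hk⟩ := ht m hm
        have : t m ≤ ∑ m ∈ Finset.range n, t m :=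
          Finset.single_le_sum (f := t) (fun _ _ => Nat.zero_le _) (Finset.mem_range.2 hm)
        exact ⟨k, mF _ _ _ _ (by omega) hk⟩
      · rintro ⟨s, -, h2, h3⟩
        refine ⟨⟨0, ⟨s, h2⟩, by simp⟩, fun {m} hm => ?_⟩
        obtain ⟨k, hk⟩ := h3 m hm
        exact ⟨k + 1, ⟨s, hk⟩, by simp⟩

/-! ### Relatively r.e. predicates and computable rational functions -/

section

variable {α β : Type} [Primcodable α] [Primcodable β] {O : Set (ℕ →. ℕ)}

theorem REPredIn.of_exists {R : α → ℕ → Bool} (hR : ComputableIn O fun p : α × ℕ => R p.1 p.2) :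
    REPredIn O fun a => ∃ n, R a n = true := by
  have h := recursiveIn_map (g := fun _ : α × ℕ => ())
    (recursiveIn_rfind (p := fun p : α × ℕ => Part.some (R p.1 p.2)) hR) (by fun_prop)
  refine h.of_eq fun a => Part.ext fun u => ?_
  simp only [Part.mem_map_iff, Part.mem_assert_iff, Part.mem_some_iff]
  constructor
  · rintro ⟨n, hn, -⟩
    exact ⟨⟨n, (Part.mem_some_iff.1 (Nat.rfind_spec hn)).symm⟩, trivial⟩
  · rintro ⟨⟨n, hn⟩, -⟩
    obtain ⟨m, hm, -⟩ := Nat.rfind_min' (p := R a) hn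
    exact ⟨m, hm, trivial⟩

/-- An r.e. predicate has a computable monotone enumeration. -/
theorem REPredIn.exists_stages (hO : TotalOracles O) {p : α → Prop} (hp : REPredIn O p) :
    ∃ R : α → ℕ → Bool, (ComputableIn O fun q : α × ℕ => R q.1 q.2) ∧
      (∀ a s t, s ≤ t → R a s = true → R a t = true) ∧ ∀ a, p a ↔ ∃ s, R a s = true := by
  obtain ⟨F, hF, mF, eF⟩ := Lowness.exists_stages hO hp
  refine ⟨fun a s => (F s (encode a)).isSome, by fun_prop, ?_, ?_⟩
  · intro a s t hst
    simp only [Option.isSome_iff_exists]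
    exact fun ⟨y, hy⟩ => ⟨y, mF _ _ _ _ hst hy⟩
  · intro a
    simp only [Option.isSome_iff_exists]
    rw [exists_comm]
    simp only [← eF]
    simp [Part.mem_assert_iff]

theorem REPredIn.of_iff {p q : α → Prop} (hp : REPredIn O p) (h : ∀ a, q a ↔ p a) :
    REPredIn O q :=
  (funext fun a => propext (h a) : q = p) ▸ hp

namespace RatComputableIn

theorem comp {f : β → ℚ} (hf : RatComputableIn O f) {g : α → β} (hg : ComputableIn O g) :
    RatComputableIn O fun a => f (g a) := by
  obtain ⟨a, b, c, ha, hb, hc, h⟩ := hf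
  exact ⟨fun x => a (g x), fun x => b (g x), fun x => c (g x), by fun_prop, by fun_prop,
    by fun_prop, fun x => h _⟩

theorem natCast {f : α → ℕ} (hf : ComputableIn O f) : RatComputableIn O fun a => (f a : ℚ) :=
  ⟨f, fun _ => 0, fun _ => 0, hf, by fun_prop, by fun_prop, by simp⟩

theorem div_natCast {f g : α → ℕ} (hf : ComputableIn O f) (hg : ComputableIn O g)
    (hpos : ∀ a, 0 < g a) : RatComputableIn O fun a => (f a : ℚ) / g a := by
  refine ⟨f, fun _ => 0, fun a => g a - 1, hf, by fun_prop, by fun_prop, fun a => ?_⟩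
  rw [Nat.cast_sub (hpos a)]
  simp

theorem const (q : ℚ) : RatComputableIn O fun _ : α => q := by
  refine ⟨fun _ => q.num.toNat, fun _ => (-q.num).toNat, fun _ => q.den - 1, by fun_prop,
    by fun_prop, by fun_prop, fun a => ?_⟩
  have h : ((q.num.toNat : ℤ) - ((-q.num).toNat : ℤ) : ℤ) = q.num := Int.toNat_sub_toNat_neg _
  rw [Nat.cast_sub q.den_pos]
  have h' : ((q.num.toNat : ℚ) - ((-q.num).toNat : ℚ)) = q.num := by exact_mod_cast h
  rw [h']
  simp [Rat.num_div_den]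

theorem add {f g : α → ℚ} (hf : RatComputableIn O f) (hg : RatComputableIn O g) :
    RatComputableIn O fun a => f a + g a := by
  obtain ⟨a, b, c, ha, hb, hc, h⟩ := hf
  obtain ⟨a', b', c', ha', hb', hc', h'⟩ := hg
  -- Denominators are stored minus one, and `c c' + c + c' = (c + 1)(c' + 1) - 1`.
  refine ⟨fun x => a x * (c' x + 1) + a' x * (c x + 1), fun x => b x * (c' x + 1) + b' x * (c x + 1),
    fun x => c x * c' x + c x + c' x, by fun_prop, by fun_prop, by fun_prop, fun x => ?_⟩
  have h1 : (c x : ℚ) + 1 ≠ 0 := by positivity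
  have h2 : (c' x : ℚ) + 1 ≠ 0 := by positivity
  have h3 : (c x : ℚ) * c' x + c x + c' x + 1 ≠ 0 := by positivity
  beta_reduce
  rw [h, h']
  push_cast
  field_simp
  ring

theorem mul {f g : α → ℚ} (hf : RatComputableIn O f) (hg : RatComputableIn O g) :
    RatComputableIn O fun a => f a * g a := by
  obtain ⟨a, b, c, ha, hb, hc, h⟩ := hf
  obtain ⟨a', b', c', ha', hb', hc', h'⟩ := hg
  refine ⟨fun x => a x * a' x + b x * b' x, fun x => a x * b' x + b x * a' x,
    fun x => c x * c' x + c x + c' x, by fun_prop, by fun_prop, by fun_prop, fun x => ?_⟩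
  have h1 : (c x : ℚ) + 1 ≠ 0 := by positivity
  have h2 : (c' x : ℚ) + 1 ≠ 0 := by positivity
  have h3 : (c x : ℚ) * c' x + c x + c' x + 1 ≠ 0 := by positivity
  beta_reduce
  rw [h, h']
  push_cast
  field_simp
  ring

theorem sub {f g : α → ℚ} (hf : RatComputableIn O f) (hg : RatComputableIn O g) :
    RatComputableIn O fun a => f a - g a := by
  simpa [sub_eq_add_neg] using hf.add ((const (-1)).mul hg)

theorem half_pow {f : α → ℕ} (hf : ComputableIn O f) :
    RatComputableIn O fun a => (1 / 2 : ℚ) ^ f a := by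
  simpa using div_natCast (f := fun _ => 1) (g := fun a => 2 ^ f a) (O := O) (by fun_prop)
    (by fun_prop) (by simp)

theorem decide_le {f g : α → ℚ} (hf : RatComputableIn O f) (hg : RatComputableIn O g) :
    ComputableIn O fun a => decide (f a ≤ g a) := by
  obtain ⟨a, b, c, ha, hb, hc, h⟩ := hf
  obtain ⟨a', b', c', ha', hb', hc', h'⟩ := hg
  have H : ComputableIn O fun x => decide (a x * (c' x + 1) + b' x * (c x + 1) ≤
      a' x * (c x + 1) + b x * (c' x + 1)) := by fun_prop
  refine H.of_eq fun x => congrArg Part.some (decide_eq_decide.2 ?_)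
  rw [h, h', div_le_div_iff₀ (by positivity) (by positivity), ← Nat.cast_le (α := ℚ)]
  push_cast
  constructor <;> intro h <;> linarith

theorem decide_lt {f g : α → ℚ} (hf : RatComputableIn O f) (hg : RatComputableIn O g) :
    ComputableIn O fun a => decide (f a < g a) := by
  have H : ComputableIn O fun x => !decide (g x ≤ f x) := by
    have := decide_le hg hf
    fun_prop
  exact H.of_eq fun x => congrArg Part.some (by simp [← not_le])

theorem sum_range {f : α → ℕ → ℚ} (hf : RatComputableIn O fun p : α × ℕ => f p.1 p.2) {n : α → ℕ}
    (hn : ComputableIn O n) : RatComputableIn O fun a => ∑ i ∈ Finset.range (n a), f a i := by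
  obtain ⟨a, b, c, ha, hb, hc, h⟩ := hf
  -- The triple carries the positive part, the negative part and the denominator minus one of the
  -- partial sum over a common denominator.
  let S : α → ℕ → ℕ × ℕ × ℕ := fun x m => Nat.rec (motive := fun _ => ℕ × ℕ × ℕ) (0, 0, 0)
    (fun i s => (s.1 * (c (x, i) + 1) + a (x, i) * (s.2.2 + 1),
      s.2.1 * (c (x, i) + 1) + b (x, i) * (s.2.2 + 1),
      s.2.2 * c (x, i) + s.2.2 + c (x, i))) m
  have hS : ComputableIn O fun x => S x (n x) := by fun_prop
  refine ⟨fun x => (S x (n x)).1, fun x => (S x (n x)).2.1, fun x => (S x (n x)).2.2,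
    by fun_prop, by fun_prop, by fun_prop, fun x => ?_⟩
  beta_reduce
  generalize n x = m
  induction m with
  | zero => simp [S]
  | succ m ih =>
    rw [Finset.sum_range_succ, ih, show f x m = _ from h (x, m)]
    have e : S x (m + 1) = ((S x m).1 * (c (x, m) + 1) + a (x, m) * ((S x m).2.2 + 1),
      (S x m).2.1 * (c (x, m) + 1) + b (x, m) * ((S x m).2.2 + 1),
      (S x m).2.2 * c (x, m) + (S x m).2.2 + c (x, m)) := rfl
    rw [e]
    generalize S x m = s
    have h1 : (c (x, m) : ℚ) + 1 ≠ 0 := by positivity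
    have h2 : (s.2.2 : ℚ) + 1 ≠ 0 := by positivity
    have h3 : (s.2.2 : ℚ) * c (x, m) + s.2.2 + c (x, m) + 1 ≠ 0 := by positivity
    push_cast
    field_simp
    ring

end RatComputableIn

end

/-! ### Cylinders, clopen sets and their measures -/

@[simp] theorem length_restrict (Z : BinSeq) (n : ℕ) : (restrict Z n).length = n := by
  simp [restrict]

theorem take_restrict (Z : BinSeq) (m n : ℕ) : (restrict Z n).take m = restrict Z (min m n) := by
  simp [restrict, ← List.map_take, List.take_range]

theorem take_restrict_of_le (Z : BinSeq) {m n : ℕ} (h : m ≤ n) :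
    (restrict Z n).take m = restrict Z m := by
  rw [take_restrict, min_eq_left h]

theorem restrict_succ (Z : BinSeq) (n : ℕ) : restrict Z (n + 1) = restrict Z n ++ [Z n] := by
  simp [restrict, List.range_succ]

theorem restrict_prefix (Z : BinSeq) {m n : ℕ} (h : m ≤ n) : restrict Z m <+: restrict Z n := by
  rw [← take_restrict_of_le Z h]
  exact List.take_prefix _ _

theorem mem_basicOpen {Z : BinSeq} {σ : Str} : Z ∈ basicOpen σ ↔ restrict Z σ.length = σ := Iff.rfl

@[simp] theorem mem_basicOpen_restrict (Z : BinSeq) (n : ℕ) : Z ∈ basicOpen (restrict Z n) := by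
  simp [mem_basicOpen]

@[simp] theorem basicOpen_nil : basicOpen [] = Set.univ := by
  ext Z; simp [mem_basicOpen, restrict]

theorem mem_basicOpen_iff_take {Z : BinSeq} {σ : Str} {n : ℕ} (h : σ.length ≤ n) :
    Z ∈ basicOpen σ ↔ (restrict Z n).take σ.length = σ := by
  rw [take_restrict_of_le Z h, mem_basicOpen]

theorem mem_basicOpen_iff_prefix {Z : BinSeq} {σ : Str} {n : ℕ} (h : σ.length ≤ n) :
    Z ∈ basicOpen σ ↔ σ <+: restrict Z n := by
  rw [mem_basicOpen_iff_take h, List.prefix_iff_eq_take, eq_comm]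

theorem basicOpen_anti {σ τ : Str} (h : σ <+: τ) : basicOpen τ ⊆ basicOpen σ := by
  intro Z hZ
  rw [mem_basicOpen_iff_prefix h.length_le, mem_basicOpen.1 hZ]
  exact h

theorem mem_basicOpen_concat {Z : BinSeq} {σ : Str} {b : Bool} :
    Z ∈ basicOpen (σ ++ [b]) ↔ Z ∈ basicOpen σ ∧ Z σ.length = b := by
  simp only [mem_basicOpen, List.length_append, List.length_singleton, restrict_succ]
  constructor
  · intro h
    have := List.append_inj h (by simp)
    simpa using this
  · rintro ⟨h1, h2⟩
    rw [h1, h2]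

theorem basicOpen_split (σ : Str) :
    basicOpen σ = basicOpen (σ ++ [false]) ∪ basicOpen (σ ++ [true]) := by
  ext Z
  simp only [Set.mem_union, mem_basicOpen_concat]
  cases Z σ.length <;> simp

theorem disjoint_basicOpen_concat (σ : Str) :
    Disjoint (basicOpen (σ ++ [false])) (basicOpen (σ ++ [true])) := by
  rw [Set.disjoint_left]
  intro Z h1 h2
  rw [mem_basicOpen_concat] at h1 h2
  simp [h1.2] at h2

theorem mem_basicOpen_iff_forall {Z : BinSeq} {σ : Str} :
    Z ∈ basicOpen σ ↔ ∀ i < σ.length, Z i = σ.getD i false := by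
  rw [mem_basicOpen]
  constructor
  · intro h i hi
    rw [← h]
    simp [restrict, hi]
  · intro h
    refine List.ext_getElem (by simp) fun i h1 h2 => ?_
    simp [restrict, h i h2, h2]

theorem basicOpen_eq_pi (σ : Str) :
    basicOpen σ = Set.pi (Finset.range σ.length) fun i => {σ.getD i false} := by
  ext Z
  simp [mem_basicOpen_iff_forall]

theorem measurableSet_basicOpen (σ : Str) : MeasurableSet (basicOpen σ) := by
  rw [basicOpen_eq_pi]
  exact MeasurableSet.pi (Finset.countable_toSet _) fun _ _ => measurableSet_singleton _

instance : IsProbabilityMeasure lebesgue := by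
  unfold lebesgue
  infer_instance

theorem lebesgue_basicOpen (σ : Str) : lebesgue.real (basicOpen σ) = (1 / 2) ^ σ.length := by
  rw [basicOpen_eq_pi, measureReal_def, lebesgue,
    Measure.infinitePi_pi _ fun _ _ => measurableSet_singleton _]
  simp

/-- The clopen set generated by a finite list of strings. -/
def cyl (S : List Str) : Set BinSeq := {Z | ∃ σ ∈ S, Z ∈ basicOpen σ}

theorem mem_cyl {S : List Str} {Z : BinSeq} : Z ∈ cyl S ↔ ∃ σ ∈ S, Z ∈ basicOpen σ := Iff.rfl

@[simp] theorem cyl_nil : cyl [] = ∅ := by ext; simp [mem_cyl]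

theorem cyl_cons (σ : Str) (S : List Str) : cyl (σ :: S) = basicOpen σ ∪ cyl S := by
  ext; simp [mem_cyl]

@[simp] theorem cyl_singleton (σ : Str) : cyl [σ] = basicOpen σ := by simp [cyl_cons]

theorem mem_cyl_flatMap {α : Type} {l : List α} {f : α → List Str} {Z : BinSeq} :
    Z ∈ cyl (l.flatMap f) ↔ ∃ a ∈ l, Z ∈ cyl (f a) := by
  simp only [mem_cyl, List.mem_flatMap]
  constructor
  · rintro ⟨σ, ⟨a, ha, h⟩, hZ⟩; exact ⟨a, ha, σ, h, hZ⟩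
  · rintro ⟨a, ha, σ, h, hZ⟩; exact ⟨σ, ⟨a, ha, h⟩, hZ⟩

theorem cyl_mono {S T : List Str} (h : S ⊆ T) : cyl S ⊆ cyl T :=
  fun _ ⟨σ, hσ, hZ⟩ => ⟨σ, h hσ, hZ⟩

theorem measurableSet_cyl (S : List Str) : MeasurableSet (cyl S) := by
  induction S with
  | nil => simp
  | cons σ S ih => rw [cyl_cons]; exact (measurableSet_basicOpen σ).union ih

/-- All strings of length `n`. -/
def allStr (n : ℕ) : List Str :=
  Nat.rec (motive := fun _ => List Str) [[]] (fun _ l => l.flatMap fun τ => [τ ++ [false], τ ++ [true]]) n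

theorem allStr_succ (n : ℕ) :
    allStr (n + 1) = (allStr n).flatMap fun τ => [τ ++ [false], τ ++ [true]] := rfl

theorem mem_allStr {n : ℕ} {τ : Str} : τ ∈ allStr n ↔ τ.length = n := by
  induction n generalizing τ with
  | zero => simp [allStr]
  | succ n ih =>
    rw [allStr_succ]
    simp only [List.mem_flatMap, ih, List.mem_cons, List.not_mem_nil, or_false]
    constructor
    · rintro ⟨ρ, hρ, rfl | rfl⟩ <;> simp [hρ]
    · intro h
      have hne : τ ≠ [] := by rintro rfl; simp at h
      refine ⟨τ.dropLast, by simp [h], ?_⟩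
      have := List.dropLast_append_getLast hne
      cases hb : τ.getLast hne <;> rw [hb] at this <;> simp [this]

theorem length_allStr (n : ℕ) : (allStr n).length = 2 ^ n := by
  induction n with
  | zero => rfl
  | succ n ih => rw [allStr_succ, List.length_flatMap]; simp [ih, pow_succ]

theorem nodup_allStr (n : ℕ) : (allStr n).Nodup := by
  induction n with
  | zero => simp [allStr]
  | succ n ih =>
    rw [allStr_succ, List.nodup_flatMap]
    refine ⟨fun τ _ => by simp, ih.imp fun {σ τ} hne => ?_⟩
    simp [Function.onFun, hne.symm]

/-- A list of strings generating the difference of two clopen sets. -/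
def diff (S T : List Str) : List Str :=
  -- The total length of all strings involved is a crude common bound, so membership in either
  -- clopen set is decided by a prefix of this length.
  (allStr (S ++ T).flatten.length).filter fun τ =>
    (S.any fun σ => decide (τ.take σ.length = σ)) && !T.any fun σ => decide (τ.take σ.length = σ)

theorem length_le_length_flatten {S : List Str} {σ : Str} (h : σ ∈ S) :
    σ.length ≤ S.flatten.length := by
  rw [List.length_flatten]
  exact List.le_sum_of_mem (List.mem_map_of_mem h)

theorem cyl_diff (S T : List Str) : cyl (diff S T) = cyl S \ cyl T := by
  ext Z
  set n := (S ++ T).flatten.length with hn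
  have hS : ∀ σ ∈ S, σ.length ≤ n := fun σ h => length_le_length_flatten (by simp [h])
  have hT : ∀ σ ∈ T, σ.length ≤ n := fun σ h => length_le_length_flatten (by simp [h])
  have key : Z ∈ cyl (diff S T) ↔ restrict Z n ∈ diff S T := by
    constructor
    · rintro ⟨τ, hτ, hZ⟩
      have : τ.length = n := mem_allStr.1 (List.mem_of_mem_filter hτ)
      rw [mem_basicOpen, this] at hZ
      rwa [hZ]
    · exact fun h => ⟨_, h, by simp⟩
  rw [key, diff, List.mem_filter, ← hn]
  simp only [mem_allStr, length_restrict, true_and, Bool.and_eq_true, List.any_eq_true,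
    decide_eq_true_eq, Bool.not_eq_true', Set.mem_sdiff, mem_cyl]
  refine and_congr (exists_congr fun σ => and_congr_right fun h => ?_) ?_
  · rw [mem_basicOpen_iff_take (hS σ h)]
  · rw [← Bool.not_eq_true, not_iff_not]
    simp only [List.any_eq_true, decide_eq_true_eq]
    exact exists_congr fun σ => and_congr_right fun h => by rw [mem_basicOpen_iff_take (hT σ h)]

theorem lebesgue_cyl_le (S : List Str) {n : ℕ} (h : ∀ σ ∈ S, σ.length = n) :
    lebesgue.real (cyl S) ≤ S.length * (1 / 2) ^ n := by
  induction S with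
  | nil => simp
  | cons σ S ih =>
    rw [cyl_cons]
    refine (measureReal_union_le _ _).trans ?_
    rw [lebesgue_basicOpen, h σ (by simp)]
    have := ih fun σ hσ => h σ (by simp [hσ])
    push_cast [List.length_cons]
    linarith

theorem lebesgue_cyl_eq (S : List Str) {n : ℕ} (h : ∀ σ ∈ S, σ.length = n) (hS : S.Nodup) :
    lebesgue.real (cyl S) = S.length * (1 / 2) ^ n := by
  induction S with
  | nil => simp
  | cons σ S ih =>
    rw [List.nodup_cons] at hS
    have hS' : ∀ σ ∈ S, σ.length = n := fun σ hσ => h σ (by simp [hσ])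
    have hd : Disjoint (basicOpen σ) (cyl S) := by
      rw [Set.disjoint_left]
      rintro Z h1 ⟨τ, hτ, h2⟩
      rw [mem_basicOpen, h σ (by simp)] at h1
      rw [mem_basicOpen, hS' τ hτ, h1] at h2
      exact hS.1 (h2 ▸ hτ)
    rw [cyl_cons, measureReal_union hd (measurableSet_cyl S), lebesgue_basicOpen, h σ (by simp),
      ih hS' hS.2]
    push_cast [List.length_cons]
    ring

/-- The measure of the clopen set generated by a finite list of strings. -/
def vol (S : List Str) : ℚ := (diff S []).length / (2 ^ S.flatten.length : ℕ)

theorem lebesgue_cyl (S : List Str) : lebesgue.real (cyl S) = (vol S : ℝ) := by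
  -- Subtracting the empty set replaces `S` by a list without repetitions whose strings all have the
  -- same length, so that measuring becomes counting.
  have h : cyl S = cyl (diff S []) := by simp [cyl_diff]
  have hnd : (diff S []).Nodup := (nodup_allStr _).filter _
  rw [h, lebesgue_cyl_eq (n := S.flatten.length) _ _ hnd]
  · simp [vol, div_eq_mul_inv]
  · intro σ hσ
    simpa using mem_allStr.1 (List.mem_of_mem_filter hσ)

section Computability

variable {α β : Type} [Primcodable α] [Primcodable β] {O : Set (ℕ →. ℕ)}

@[fun_prop]
theorem computableIn_allStr {f : α → ℕ} (hf : ComputableIn O f) :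
    ComputableIn O fun a => allStr (f a) := by
  unfold allStr
  fun_prop

@[fun_prop]
theorem computableIn_diff {f g : α → List Str} (hf : ComputableIn O f) (hg : ComputableIn O g) :
    ComputableIn O fun a => diff (f a) (g a) := by
  unfold diff
  fun_prop

theorem ratComputableIn_vol {f : α → List Str} (hf : ComputableIn O f) :
    RatComputableIn O fun a => vol (f a) :=
  RatComputableIn.div_natCast (by fun_prop) (by fun_prop) (by simp)

end Computability

/-! ### Clopen sequences and tests -/

theorem lebesgue_iUnion_le {E : ℕ → Set BinSeq} {n : ℕ}
    (h : ∀ j, lebesgue.real (E j) ≤ (1 / 2) ^ (n + 1 + j)) :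
    lebesgue.real (⋃ j, E j) ≤ (1 / 2) ^ n := by
  have hs : HasSum (fun j : ℕ => (1 / 2 : ℝ) ^ (n + 1 + j)) ((1 / 2) ^ n) := by
    have := (hasSum_geometric_two' ((1 / 2 : ℝ) ^ n))
    convert this using 2 with j
    rw [pow_add, pow_succ]
    simp
    ring
  rw [measureReal_def]
  refine ENNReal.toReal_le_of_le_ofReal (by positivity) ?_
  refine (measure_iUnion_le _).trans ?_
  rw [← hs.tsum_eq, ENNReal.ofReal_tsum_of_nonneg (fun _ => by positivity) hs.summable]
  refine ENNReal.tsum_le_tsum fun j => ?_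
  rw [← ofReal_measureReal]
  exact ENNReal.ofReal_le_ofReal (h j)

variable {O : Set (ℕ →. ℕ)}

/-- The real lies in the tail unions of a sequence of sets that it enters infinitely often. -/
theorem exists_mem_tail {E : ℕ → Set BinSeq} {Z : BinSeq} (hZ : ∃ᶠ n in atTop, Z ∈ E n) (n : ℕ) :
    ∃ m, Z ∈ E (n + 1 + m) := by
  obtain ⟨m, hm, h⟩ := frequently_atTop.1 hZ (n + 1)
  exact ⟨m - (n + 1), by rwa [Nat.add_sub_cancel' hm]⟩

/-- An effective Borel–Cantelli lemma: the tail unions form a Schnorr test. Their measures are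
computable because finitely many clopen sets can be measured exactly and the part beyond the first
`k` has measure at most `2⁻ᵏ`. -/
theorem notMem_SR_of_clopen {f : ℕ → List Str} (hf : ComputableIn O f)
    (hμ : ∀ n, lebesgue.real (cyl (f n)) ≤ (1 / 2) ^ n) {Z : BinSeq}
    (hZ : ∃ᶠ n in atTop, Z ∈ cyl (f n)) : Z ∉ SR O := by
  let U : ℕ → Set BinSeq := fun n => ⋃ m, cyl (f (n + 1 + m))
  have hU : ∀ n, lebesgue.real (U n) ≤ (1 / 2) ^ n := fun n =>
    lebesgue_iUnion_le fun j => hμ _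
  suffices hT : IsSchnorrTest O U by
    intro h
    obtain ⟨n, hn⟩ := h U hT
    exact hn (Set.mem_iUnion.2 (exists_mem_tail hZ n))
  refine ⟨⟨⟨fun p => ∃ m, ((f (p.1 + 1 + m)).any fun τ => decide (τ = p.2)) = true,
    REPredIn.of_exists (by fun_prop), fun n => ?_⟩, hU⟩,
    fun p => vol ((List.range p.2).flatMap fun j => f (p.1 + 1 + j)),
    ratComputableIn_vol (by fun_prop), fun n k => ?_⟩
  · ext Z
    simp only [U, Set.mem_iUnion, mem_cyl, List.any_eq_true, decide_eq_true_eq, Set.mem_ofPred_eq]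
    constructor
    · rintro ⟨m, σ, h1, h2⟩; exact ⟨σ, ⟨m, σ, h1, rfl⟩, h2⟩
    · rintro ⟨_, ⟨m, σ, h1, rfl⟩, h2⟩; exact ⟨m, σ, h1, h2⟩
  · rw [← lebesgue_cyl]
    set S := (List.range k).flatMap fun j => f (n + 1 + j) with hS
    have h1 : cyl S ⊆ U n := by
      intro Z hZ
      obtain ⟨j, -, h⟩ := mem_cyl_flatMap.1 hZ
      exact Set.mem_iUnion.2 ⟨j, h⟩
    have h2 : U n ⊆ cyl S ∪ U (n + k) := by
      intro Z hZ
      obtain ⟨j, hj⟩ := Set.mem_iUnion.1 hZ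
      rcases lt_or_ge j k with hlt | hge
      · exact Or.inl (mem_cyl_flatMap.2 ⟨j, by simpa using hlt, hj⟩)
      · refine Or.inr (Set.mem_iUnion.2 ⟨j - k, ?_⟩)
        rwa [show n + k + 1 + (j - k) = n + 1 + j by omega]
    have h3 := measureReal_mono (μ := lebesgue) h1
    have h4 := (measureReal_mono (μ := lebesgue) h2).trans (measureReal_union_le _ _)
    have h5 : (1 / 2 : ℝ) ^ (n + k) ≤ (1 / 2) ^ k :=
      pow_le_pow_of_le_one (by norm_num) (by norm_num) (by omega)
    have h6 := hU (n + k)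
    rw [abs_le]
    constructor <;> linarith [show (0 : ℝ) ≤ (1 / 2) ^ k by positivity]

/-- The same tail unions serve here. The sets are only enumerated, so their measures need not be
computable and the result is only a Martin-Löf test. -/
theorem notMem_MR_of_sigma1 (hO : TotalOracles O) {V : ℕ × Str → Prop} (hV : REPredIn O V)
    (hμ : ∀ n, lebesgue.real {Z | ∃ σ, V (n, σ) ∧ Z ∈ basicOpen σ} ≤ (1 / 2) ^ n) {Z : BinSeq}
    (hZ : ∃ᶠ n in atTop, ∃ σ, V (n, σ) ∧ Z ∈ basicOpen σ) : Z ∉ MR O := by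
  obtain ⟨R, hR, -, eR⟩ := hV.exists_stages hO
  let E : ℕ → Set BinSeq := fun n => {Z | ∃ σ, V (n, σ) ∧ Z ∈ basicOpen σ}
  let U : ℕ → Set BinSeq := fun n => ⋃ m, E (n + 1 + m)
  suffices hT : IsMLTest O U by
    intro h
    obtain ⟨n, hn⟩ := h U hT
    exact hn (Set.mem_iUnion.2 (exists_mem_tail (E := E) hZ n))
  refine ⟨⟨fun p => ∃ i, R (p.1 + 1 + (Nat.unpair i).1, p.2) (Nat.unpair i).2 = true,
    REPredIn.of_exists (R := fun (p : ℕ × Str) i =>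
      R (p.1 + 1 + (Nat.unpair i).1, p.2) (Nat.unpair i).2) (by fun_prop), fun n => ?_⟩,
    fun n => lebesgue_iUnion_le fun j => hμ _⟩
  ext Z
  simp only [U, E, Set.mem_iUnion, Set.mem_ofPred_eq, eR]
  constructor
  · rintro ⟨m, σ, ⟨s, h1⟩, h2⟩; exact ⟨σ, ⟨Nat.pair m s, by simpa using h1⟩, h2⟩
  · rintro ⟨σ, ⟨i, h1⟩, h2⟩; exact ⟨_, σ, ⟨_, h1⟩, h2⟩

theorem tendsto_lebesgue_cyl {S : ℕ → List Str} (hS : Monotone fun s => cyl (S s)) :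
    Tendsto (fun s => lebesgue.real (cyl (S s))) atTop (nhds (lebesgue.real (⋃ s, cyl (S s)))) :=
  (ENNReal.tendsto_toReal (measure_ne_top _ _)).comp (tendsto_measure_iUnion_atTop hS)

/-- A uniformly `Σ⁰₁` sequence of classes is uniformly a union of computable increasing
clopen sets. -/
theorem UniformSigma1.exists_stages (hO : TotalOracles O) {U : ℕ → Set BinSeq}
    (hU : UniformSigma1 O U) :
    ∃ S : ℕ → ℕ → List Str, (ComputableIn O fun p : ℕ × ℕ => S p.1 p.2) ∧
      (∀ n, Monotone fun s => cyl (S n s)) ∧ ∀ n, U n = ⋃ s, cyl (S n s) := by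
  obtain ⟨W, hW, hU⟩ := hU
  obtain ⟨R, hR, mR, eR⟩ := hW.exists_stages hO
  let S : ℕ → ℕ → List Str := fun n s =>
    ((List.range s).flatMap allStr).filter fun σ => R (n, σ) s
  have hmem : ∀ n s σ, σ ∈ S n s ↔ σ.length < s ∧ R (n, σ) s = true := by
    intro n s σ
    simp [S, mem_allStr]
  refine ⟨S, by fun_prop, fun n s t hst => cyl_mono fun σ => ?_, fun n => ?_⟩
  · rw [hmem, hmem]
    exact fun h => ⟨h.1.trans_le hst, mR _ _ _ hst h.2⟩
  · ext Z
    simp only [hU, Set.mem_iUnion, mem_cyl, Set.mem_ofPred_eq, eR, hmem]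
    constructor
    · rintro ⟨σ, ⟨s, h1⟩, h2⟩
      exact ⟨max s (σ.length + 1), σ, ⟨by omega, mR _ _ _ (le_max_left _ _) h1⟩, h2⟩
    · rintro ⟨s, σ, ⟨-, h1⟩, h2⟩
      exact ⟨σ, ⟨s, h1⟩, h2⟩

/-- A real that is not Schnorr random enters infinitely many members of a computable sequence of
clopen sets whose measures are as small as prescribed. -/
theorem exists_clopen_of_notMem_SR (hO : TotalOracles O) {Z : BinSeq} (hZ : Z ∉ SR O) {ε : ℕ → ℕ}
    (hε : ComputableIn O ε) :
    ∃ f : ℕ → List Str, ComputableIn O f ∧ (∀ n, lebesgue.real (cyl (f n)) ≤ (1 / 2) ^ ε n) ∧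
      ∃ᶠ n in atTop, Z ∈ cyl (f n) := by
  simp only [SR, Set.mem_ofPred_eq, not_forall, not_exists, not_not] at hZ
  obtain ⟨U, ⟨⟨hU, hμ⟩, q, hq, hqU⟩, hZU⟩ := hZ
  obtain ⟨S, hS, mS, eS⟩ := hU.exists_stages hO
  -- The component `U (g k)` is cut into pieces indexed by `(k, j)`, each the difference of two
  -- successive approximations. The approximation used for `(k, j)` misses at most `3 · 2⁻ᵉ` of the
  -- component: `2 · 2⁻ᵉ` by the test in `P` and `2⁻ᵉ` by the error of `q`. With the summand `2` in
  -- `e` this is three quarters of the bound prescribed for the piece `(k, j + 1)`.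
  let e : ℕ × ℕ → ℕ := fun p => ε (Nat.pair p.1 (p.2 + 1)) + 2
  let g : ℕ → ℕ := fun k => ε (Nat.pair k 0)
  -- The condition `p.2 ≤ s` forces the stages to be unbounded, so the approximations exhaust the
  -- component.
  let P : ℕ × ℕ → ℕ → Bool := fun p s => decide (p.2 ≤ s) &&
    decide (q (g p.1, e p) ≤ vol (S (g p.1) s) + 2 * (1 / 2) ^ e p)
  have hg : ComputableIn O g := by fun_prop
  have he : ComputableIn O e := by fun_prop
  have hP : ComputableIn O fun r : (ℕ × ℕ) × ℕ => P r.1 r.2 := by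
    have h1 : ComputableIn O fun r : (ℕ × ℕ) × ℕ =>
        decide (q (g r.1.1, e r.1) ≤ vol (S (g r.1.1) r.2) + 2 * (1 / 2) ^ e r.1) := by
      have a1 : RatComputableIn O fun r : (ℕ × ℕ) × ℕ => q (g r.1.1, e r.1) :=
        hq.comp (g := fun r : (ℕ × ℕ) × ℕ => (g r.1.1, e r.1)) (by fun_prop)
      have a2 : RatComputableIn O fun r : (ℕ × ℕ) × ℕ => vol (S (g r.1.1) r.2) :=
        ratComputableIn_vol (by fun_prop)
      have a3 : RatComputableIn O fun r : (ℕ × ℕ) × ℕ => (1 / 2 : ℚ) ^ e r.1 :=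
        RatComputableIn.half_pow (by fun_prop)
      exact a1.decide_le (a2.add ((RatComputableIn.const 2).mul a3))
    have h2 : ComputableIn O fun r : (ℕ × ℕ) × ℕ => decide (r.1.2 ≤ r.2) :=
      computableIn_decide_le (by fun_prop) (by fun_prop)
    exact computableIn_and h2 h1
  have hPiff : ∀ p s, P p s = true ↔ p.2 ≤ s ∧
      (q (g p.1, e p) : ℝ) ≤ lebesgue.real (cyl (S (g p.1) s)) + 2 * (1 / 2) ^ e p := by
    intro p s
    simp only [P, Bool.and_eq_true, decide_eq_true_eq, lebesgue_cyl]
    rw [← Rat.cast_le (K := ℝ)]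
    push_cast
    rfl
  have hex : ∀ p, ∃ s, P p s = true := by
    intro p
    have ht := tendsto_lebesgue_cyl (mS (g p.1))
    rw [← eS] at ht
    have h0 : (0 : ℝ) < (1 / 2) ^ e p := by positivity
    obtain ⟨s, hs, hsp⟩ := ((ht.eventually (lt_mem_nhds (sub_lt_self (lebesgue.real (U (g p.1))) h0))).and
      (eventually_ge_atTop p.2)).exists
    refine ⟨s, (hPiff _ _).2 ⟨hsp, ?_⟩⟩
    have := abs_le.1 (hqU (g p.1) (e p))
    linarith
  let st : ℕ × ℕ → ℕ := fun p => Nat.find (hex p)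
  have hst : ComputableIn O st := computableIn_find hP hex
  have hspec : ∀ p, p.2 ≤ st p ∧
      (q (g p.1, e p) : ℝ) ≤ lebesgue.real (cyl (S (g p.1) (st p))) + 2 * (1 / 2) ^ e p :=
    fun p => (hPiff _ _).1 (Nat.find_spec (hex p))
  let C : ℕ × ℕ → List Str := fun p => bif decide (p.2 = 0) then S (g p.1) (st p) else
    diff (S (g p.1) (st p)) (S (g p.1) (st (p.1, p.2 - 1)))
  have hC : ComputableIn O C := by fun_prop
  refine ⟨fun m => C m.unpair, by fun_prop, fun m => ?_, frequently_atTop.2 fun N => ?_⟩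
  · have hm : Nat.pair m.unpair.1 m.unpair.2 = m := Nat.pair_unpair m
    generalize m.unpair.1 = k at hm
    generalize hj : m.unpair.2 = j at hm
    rw [← hm]
    simp only [Nat.unpair_pair]
    have hsub : ∀ s, cyl (S (g k) s) ⊆ U (g k) := fun s => by
      rw [eS]; exact Set.subset_iUnion (fun s => cyl (S (g k) s)) s
    rcases j with _ | j
    · exact (measureReal_mono (hsub _)).trans (hμ _)
    · simp only [C, Nat.add_sub_cancel, Nat.add_eq_zero_iff, one_ne_zero, and_false, decide_false, cond_false, cyl_diff]
      refine (measureReal_mono (Set.sdiff_subset_sdiff_left (hsub _))).trans ?_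
      rw [measureReal_sdiff (hsub _) (measurableSet_cyl _)]
      have h1 := (hspec (k, j)).2
      have h2 := abs_le.1 (hqU (g k) (e (k, j)))
      simp only at h1 h2
      have h3 : (1 / 2 : ℝ) ^ e (k, j) = (1 / 2) ^ ε (Nat.pair k (j + 1)) / 4 := by
        simp only [e, pow_add]; norm_num; ring
      have h4 : (0 : ℝ) < (1 / 2) ^ ε (Nat.pair k (j + 1)) := by positivity
      linarith
  · have hZ' := hZU (g N)
    rw [eS, Set.mem_iUnion] at hZ'
    have hex' : ∃ j, Z ∈ cyl (S (g N) (st (N, j))) := by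
      obtain ⟨s, hs⟩ := hZ'
      exact ⟨s, mS _ (hspec (N, s)).1 hs⟩
    classical
    -- At the least `j` whose approximation contains `Z`, the previous approximation omits it, so
    -- `Z` lies in the piece `(N, j)`. Its index is at least `N`.
    refine ⟨Nat.pair N (Nat.find hex'), Nat.left_le_pair _ _, ?_⟩
    simp only [Nat.unpair_pair, C]
    have h1 := Nat.find_spec hex'
    have h2 := fun m => @Nat.find_min _ _ hex' m
    generalize Nat.find hex' = j at h1 h2
    rcases j with _ | j
    · exact h1
    · simp only [Nat.add_sub_cancel, Nat.add_eq_zero_iff, one_ne_zero, and_false, decide_false, cond_false, cyl_diff]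
      exact ⟨h1, h2 j (Nat.lt_succ_self j)⟩

/-! ### Martin-Löf randomness implies computable randomness -/

/-- Ville's inequality for strings extending `σ` by at most `L` bits. -/
theorem ville_le {M : Str → ℚ} (h0 : ∀ σ, 0 ≤ M σ)
    (hfair : ∀ σ, M (σ ++ [false]) + M (σ ++ [true]) = 2 * M σ) (c : ℝ) (L : ℕ) (σ : Str) :
    c * lebesgue.real {Z | Z ∈ basicOpen σ ∧ ∃ m, σ.length ≤ m ∧ m ≤ σ.length + L ∧
      c < M (restrict Z m)} ≤ (1 / 2) ^ σ.length * M σ := by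
  have hpos : (0 : ℝ) ≤ M σ := by exact_mod_cast h0 σ
  rcases le_or_gt c 0 with hc | hc
  · exact (mul_nonpos_of_nonpos_of_nonneg hc measureReal_nonneg).trans (by positivity)
  by_cases hσ : c < M σ
  · have : lebesgue.real {Z | Z ∈ basicOpen σ ∧ ∃ m, σ.length ≤ m ∧ m ≤ σ.length + L ∧
        c < M (restrict Z m)} ≤ (1 / 2) ^ σ.length := by
      rw [← lebesgue_basicOpen]
      exact measureReal_mono fun Z hZ => hZ.1
    calc _ ≤ c * (1 / 2) ^ σ.length := by gcongr
      _ ≤ M σ * (1 / 2) ^ σ.length := by gcongr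
      _ = _ := mul_comm _ _
  induction L generalizing σ with
  | zero =>
    have : {Z | Z ∈ basicOpen σ ∧ ∃ m, σ.length ≤ m ∧ m ≤ σ.length + 0 ∧
        c < M (restrict Z m)} = ∅ := by
      ext Z
      simp only [Set.mem_ofPred_eq, Set.mem_empty_iff_false, iff_false]
      rintro ⟨hZ, m, h1, h2, h3⟩
      obtain rfl : m = σ.length := by omega
      rw [mem_basicOpen.1 hZ] at h3
      exact hσ h3
    rw [this]
    simp only [measureReal_empty, mul_zero]
    positivity
  | succ L ih =>
    let E : Str → Set BinSeq := fun τ => {Z | Z ∈ basicOpen τ ∧ ∃ m, τ.length ≤ m ∧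
      m ≤ τ.length + L ∧ c < M (restrict Z m)}
    have hE : ∀ τ, c * lebesgue.real (E τ) ≤ (1 / 2) ^ τ.length * M τ := by
      intro τ
      have hpos : (0 : ℝ) ≤ M τ := by exact_mod_cast h0 τ
      by_cases hτ : c < M τ
      · have : lebesgue.real (E τ) ≤ (1 / 2) ^ τ.length := by
          rw [← lebesgue_basicOpen]
          exact measureReal_mono fun Z hZ => hZ.1
        calc _ ≤ c * (1 / 2) ^ τ.length := by gcongr
          _ ≤ M τ * (1 / 2) ^ τ.length := by gcongr
          _ = _ := mul_comm _ _
      · exact ih τ hpos hτ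
    -- As the capital at `σ` does not exceed `c`, the threshold is passed strictly later, below one
    -- of the two children; fairness averages their bounds.
    have hsub : {Z | Z ∈ basicOpen σ ∧ ∃ m, σ.length ≤ m ∧ m ≤ σ.length + (L + 1) ∧
        c < M (restrict Z m)} ⊆ E (σ ++ [false]) ∪ E (σ ++ [true]) := by
      rintro Z ⟨hZ, m, h1, h2, h3⟩
      have hm : m ≠ σ.length := by
        rintro rfl
        rw [mem_basicOpen.1 hZ] at h3
        exact hσ h3
      rw [basicOpen_split] at hZ
      have hb : ∀ b : Bool, σ.length + 1 = (σ ++ [b]).length := fun b => by simp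
      rcases hZ with hZ | hZ
      · exact Or.inl ⟨hZ, m, by rw [← hb]; omega, by rw [← hb]; omega, h3⟩
      · exact Or.inr ⟨hZ, m, by rw [← hb]; omega, by rw [← hb]; omega, h3⟩
    have h1 := (measureReal_mono (μ := lebesgue) hsub).trans (measureReal_union_le _ _)
    have h2 := hE (σ ++ [false])
    have h3 := hE (σ ++ [true])
    have h4 : (M (σ ++ [false]) : ℝ) + M (σ ++ [true]) = 2 * M σ := by exact_mod_cast hfair σ
    simp only [List.length_append, List.length_singleton, pow_succ] at h2 h3
    calc _ ≤ c * (lebesgue.real (E (σ ++ [false])) + lebesgue.real (E (σ ++ [true]))) := by gcongr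
      _ ≤ (1 / 2) ^ σ.length * (1 / 2) * M (σ ++ [false]) +
          (1 / 2) ^ σ.length * (1 / 2) * M (σ ++ [true]) := by linarith
      _ = (1 / 2) ^ σ.length * (1 / 2) * (M (σ ++ [false]) + M (σ ++ [true])) := by ring
      _ = _ := by rw [h4]; ring

/-- **Ville's inequality.** -/
theorem IsMartingale.ville {M : Str → ℚ} (hM : IsMartingale M) (c : ℝ) :
    c * lebesgue.real {Z | ∃ σ, c < M σ ∧ Z ∈ basicOpen σ} ≤ 1 := by
  have hmono : Monotone fun L : ℕ => {Z : BinSeq | Z ∈ basicOpen [] ∧ ∃ m, ([] : Str).length ≤ m ∧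
      m ≤ ([] : Str).length + L ∧ c < M (restrict Z m)} := by
    rintro L L' h Z ⟨h1, m, h2, h3, h4⟩
    exact ⟨h1, m, h2, by omega, h4⟩
  have heq : {Z | ∃ σ, c < M σ ∧ Z ∈ basicOpen σ} = ⋃ L : ℕ, {Z : BinSeq | Z ∈ basicOpen [] ∧
      ∃ m, ([] : Str).length ≤ m ∧ m ≤ ([] : Str).length + L ∧ c < M (restrict Z m)} := by
    ext Z
    simp only [Set.mem_iUnion, Set.mem_ofPred_eq]
    constructor
    · rintro ⟨σ, h1, h2⟩
      exact ⟨σ.length, by simp, σ.length, by simp, by simp, by rwa [mem_basicOpen.1 h2]⟩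
    · rintro ⟨L, -, m, -, -, h⟩
      exact ⟨restrict Z m, h, by simp⟩
  rw [heq]
  have ht := ((ENNReal.tendsto_toReal (measure_ne_top lebesgue _)).comp
    (tendsto_measure_iUnion_atTop hmono)).const_mul c
  refine le_of_tendsto' ht fun L => (ville_le hM.nonneg hM.fair c L []).trans ?_
  have := hM.init_le
  simpa using (by exact_mod_cast this : (M [] : ℝ) ≤ 1)

/-- By Ville's inequality the sets where the capital exceeds `2ⁿ` somewhere have measure at most
`2⁻ⁿ`, and they are uniformly `Σ⁰₁`. -/
theorem MR_subset_CR {O : Set (ℕ →. ℕ)} (hO : TotalOracles O) : MR O ⊆ CR O := by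
  intro Z hZ M hM hMc hs
  refine notMem_MR_of_sigma1 (V := fun p => 2 ^ p.1 < M p.2) hO ?_ (fun n => ?_) (Z := Z) ?_ hZ
  · have h : ComputableIn O fun q : (ℕ × Str) × ℕ => decide ((2 ^ q.1.1 : ℕ) < M q.1.2) :=
      (RatComputableIn.natCast (by fun_prop)).decide_lt
        (hMc.comp (g := fun q : (ℕ × Str) × ℕ => q.1.2) (by fun_prop))
    refine (REPredIn.of_exists (R := fun (p : ℕ × Str) _ => decide ((2 ^ p.1 : ℕ) < M p.2)) h).of_iff
      fun p => ?_
    simp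
  · have h := hM.ville (2 ^ n)
    have heq : {Z | ∃ σ, 2 ^ n < M σ ∧ Z ∈ basicOpen σ} =
        {Z | ∃ σ, (2 : ℝ) ^ n < M σ ∧ Z ∈ basicOpen σ} := by
      ext Z
      simp only [Set.mem_ofPred_eq]
      exact exists_congr fun σ => and_congr_left fun _ => by
        rw [← Rat.cast_lt (K := ℝ)]; push_cast; rfl
    simp only [heq]
    rw [one_div, inv_pow, ← one_div, le_div_iff₀ (by positivity), mul_comm]
    exact h
  · refine Eventually.frequently (Eventually.of_forall fun n => ?_)
    obtain ⟨m, hm⟩ := (hs (2 ^ n)).exists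
    exact ⟨restrict Z m, hm, by simp⟩

/-! ### Computable randomness implies Schnorr randomness -/

/-- A list of strings generating the intersection of two clopen sets. -/
def inter (S T : List Str) : List Str := diff S (diff S T)

theorem cyl_inter (S T : List Str) : cyl (inter S T) = cyl S ∩ cyl T := by
  simp [inter, cyl_diff]

@[fun_prop]
theorem computableIn_inter {α : Type} [Primcodable α] {O : Set (ℕ →. ℕ)} {f g : α → List Str}
    (hf : ComputableIn O f) (hg : ComputableIn O g) :
    ComputableIn O fun a => inter (f a) (g a) := by
  unfold inter
  fun_prop

/-- The conditional measure of the clopen set generated by `S` inside the cylinder of `σ`. -/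
def condVol (S : List Str) (σ : Str) : ℚ := vol (inter S [σ]) * (2 ^ σ.length : ℕ)

theorem condVol_cast (S : List Str) (σ : Str) :
    (condVol S σ : ℝ) = lebesgue.real (cyl S ∩ basicOpen σ) * 2 ^ σ.length := by
  rw [condVol]
  push_cast
  rw [← lebesgue_cyl, cyl_inter, cyl_singleton]

theorem condVol_nonneg (S : List Str) (σ : Str) : 0 ≤ condVol S σ := by
  have : (0 : ℝ) ≤ condVol S σ := by rw [condVol_cast]; positivity
  exact_mod_cast this

theorem condVol_fair (S : List Str) (σ : Str) :
    condVol S (σ ++ [false]) + condVol S (σ ++ [true]) = 2 * condVol S σ := by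
  have : (condVol S (σ ++ [false]) + condVol S (σ ++ [true]) : ℝ) = 2 * condVol S σ := by
    simp only [condVol_cast]
    rw [basicOpen_split σ, Set.inter_union_distrib_left, measureReal_union
      ((disjoint_basicOpen_concat σ).mono Set.inter_subset_right Set.inter_subset_right)
      ((measurableSet_cyl S).inter (measurableSet_basicOpen _))]
    simp only [List.length_append, List.length_singleton, pow_succ]
    ring
  exact_mod_cast this

theorem condVol_eq_one {S : List Str} {σ : Str} (h : basicOpen σ ⊆ cyl S) : condVol S σ = 1 := by
  have : (condVol S σ : ℝ) = 1 := by
    rw [condVol_cast, Set.inter_eq_right.2 h, lebesgue_basicOpen, ← mul_pow]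
    norm_num
  exact_mod_cast this

/-- The strategy that from length `n` on bets `1 / 2 ^ n` on the clopen set generated by `S`. -/
def betOn (n : ℕ) (S : List Str) (σ : Str) : ℚ :=
  -- If `S` has measure at most `2⁻⁴ⁿ`, its conditional measure at length `n` is at most `2⁻⁴ⁿ · 2ⁿ
  -- = 8⁻ⁿ`. Hence the factor `8ⁿ` keeps the capital nonnegative, and inside `S` the capital reaches
  -- at least `2⁻ⁿ · 8ⁿ = 4ⁿ`.
  (1 / 2) ^ n * (1 + (8 ^ n : ℕ) * (condVol S σ - condVol S (σ.take n)))

theorem betOn_of_length_le {n : ℕ} {S : List Str} {σ : Str} (h : σ.length ≤ n) :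
    betOn n S σ = (1 / 2) ^ n := by
  rw [betOn, List.take_of_length_le h]
  simp

theorem betOn_fair {n : ℕ} {S : List Str} {σ : Str} (h : n ≤ σ.length) :
    betOn n S (σ ++ [false]) + betOn n S (σ ++ [true]) = 2 * betOn n S σ := by
  have h1 := condVol_fair S σ
  simp only [betOn, List.take_append_of_le_length h]
  rw [show condVol S (σ ++ [true]) = 2 * condVol S σ - condVol S (σ ++ [false]) by linarith]
  ring

theorem condVol_take_le {n : ℕ} {S : List Str} {σ : Str}
    (hS : lebesgue.real (cyl S) ≤ (1 / 2) ^ (4 * n)) :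
    (8 ^ n : ℕ) * condVol S (σ.take n) ≤ 1 := by
  have : ((8 ^ n : ℕ) : ℝ) * condVol S (σ.take n) ≤ 1 := by
    rw [condVol_cast]
    have h1 : lebesgue.real (cyl S ∩ basicOpen (σ.take n)) ≤ (1 / 2) ^ (4 * n) :=
      (measureReal_mono Set.inter_subset_left).trans hS
    have h2 : (2 : ℝ) ^ (σ.take n).length ≤ 2 ^ n :=
      pow_le_pow_right₀ (by norm_num) (by simp)
    calc _ ≤ ((8 ^ n : ℕ) : ℝ) * ((1 / 2) ^ (4 * n) * 2 ^ n) := by gcongr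
      _ = ((8 : ℝ) * ((1 / 2) ^ 4 * 2)) ^ n := by
        rw [mul_pow, mul_pow, pow_mul]; push_cast; ring
      _ = 1 := by norm_num
  exact_mod_cast this

theorem betOn_nonneg {n : ℕ} {S : List Str} {σ : Str}
    (hS : lebesgue.real (cyl S) ≤ (1 / 2) ^ (4 * n)) : 0 ≤ betOn n S σ := by
  have h1 := condVol_take_le (σ := σ) hS
  have h2 : 0 ≤ ((8 ^ n : ℕ) : ℚ) * condVol S σ := mul_nonneg (by positivity) (condVol_nonneg S σ)
  refine mul_nonneg (by positivity) ?_
  linarith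

theorem le_betOn {n : ℕ} {S : List Str} {σ : Str}
    (hS : lebesgue.real (cyl S) ≤ (1 / 2) ^ (4 * n)) (hσ : basicOpen σ ⊆ cyl S) :
    4 ^ n ≤ betOn n S σ := by
  have h1 := condVol_take_le (σ := σ) hS
  rw [betOn, condVol_eq_one hσ]
  calc (4 : ℚ) ^ n = (1 / 2) ^ n * ((8 ^ n : ℕ) : ℚ) := by
        push_cast; rw [← mul_pow]; norm_num
    _ ≤ _ := by gcongr; linarith

/-- A real that is not Schnorr random enters infinitely many clopen sets of measure at most `2⁻⁴ⁿ`;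
the sum of the bets on all of them exceeds every bound along it. -/
theorem CR_subset_SR {O : Set (ℕ →. ℕ)} (hO : TotalOracles O) : CR O ⊆ SR O := by
  intro Z hZ
  by_contra hSR
  obtain ⟨f, hf, hμ, hfZ⟩ := exists_clopen_of_notMem_SR hO hSR (ε := fun n => 4 * n) (by fun_prop)
  -- This is the exact value of the infinite sum of bets: those with index above `σ.length` still
  -- hold their stakes, which add up to `2` to the power `-σ.length`.
  let M : Str → ℚ := fun σ =>
    ∑ n ∈ Finset.range σ.length, betOn (n + 1) (f (n + 1)) σ + (1 / 2) ^ σ.length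
  have hM : IsMartingale M := by
    refine ⟨fun σ => ?_, by simp [M], fun σ => ?_⟩
    · exact add_nonneg (Finset.sum_nonneg fun n _ => betOn_nonneg (hμ _)) (by positivity)
    · have hb : ∀ b : Bool, M (σ ++ [b]) = ∑ n ∈ Finset.range σ.length,
          betOn (n + 1) (f (n + 1)) (σ ++ [b]) + (1 / 2) ^ σ.length := by
        intro b
        simp only [M, List.length_append, List.length_singleton, Finset.sum_range_succ]
        rw [betOn_of_length_le (σ := σ ++ [b]) (by simp), pow_succ]
        ring
      have hs : ∑ n ∈ Finset.range σ.length, (betOn (n + 1) (f (n + 1)) (σ ++ [false]) +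
          betOn (n + 1) (f (n + 1)) (σ ++ [true])) =
          ∑ n ∈ Finset.range σ.length, 2 * betOn (n + 1) (f (n + 1)) σ :=
        Finset.sum_congr rfl fun n hn => betOn_fair (Finset.mem_range.1 hn)
      rw [Finset.sum_add_distrib, ← Finset.mul_sum] at hs
      rw [hb, hb]
      simp only [M]
      linarith
  have hMc : RatComputableIn O M := by
    have hcv : ∀ {g : Str × ℕ → Str}, ComputableIn O g →
        RatComputableIn O fun p : Str × ℕ => condVol (f (p.2 + 1)) (g p) := fun {g} hg =>
      (ratComputableIn_vol (by fun_prop)).mul (RatComputableIn.natCast (by fun_prop))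
    have hbet : RatComputableIn O fun p : Str × ℕ => betOn (p.2 + 1) (f (p.2 + 1)) p.1 :=
      (RatComputableIn.half_pow (by fun_prop)).mul ((RatComputableIn.const 1).add
        ((RatComputableIn.natCast (by fun_prop)).mul
          ((hcv (g := fun p => p.1) (by fun_prop)).sub
            (hcv (g := fun p => p.1.take (p.2 + 1)) (by fun_prop)))))
    exact (RatComputableIn.sum_range (f := fun σ n => betOn (n + 1) (f (n + 1)) σ) hbet
      (by fun_prop)).add (RatComputableIn.half_pow (by fun_prop))
  refine hZ M hM hMc fun c => frequently_atTop.2 fun N => ?_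
  obtain ⟨k, hk⟩ := pow_unbounded_of_one_lt c (show (1 : ℚ) < 4 by norm_num)
  obtain ⟨n, hn, hnZ⟩ := frequently_atTop.1 hfZ (k + 1)
  obtain ⟨n, rfl⟩ : ∃ m, n = m + 1 := ⟨n - 1, by omega⟩
  obtain ⟨σ, hσ, hσZ⟩ := hnZ
  refine ⟨max (max N (n + 1)) σ.length, by simp, ?_⟩
  set L := max (max N (n + 1)) σ.length
  have hsub : basicOpen (restrict Z L) ⊆ cyl (f (n + 1)) := by
    refine fun Y hY => ⟨σ, hσ, basicOpen_anti ?_ hY⟩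
    rw [← mem_basicOpen.1 hσZ]
    exact restrict_prefix _ (le_max_right _ _)
  calc c < 4 ^ k := hk
    _ ≤ 4 ^ (n + 1) := pow_le_pow_right₀ (by norm_num) (by omega)
    _ ≤ betOn (n + 1) (f (n + 1)) (restrict Z L) := le_betOn (hμ _) hsub
    _ ≤ ∑ n ∈ Finset.range (restrict Z L).length, betOn (n + 1) (f (n + 1)) (restrict Z L) :=
      Finset.single_le_sum (f := fun n => betOn (n + 1) (f (n + 1)) (restrict Z L))
        (fun n _ => betOn_nonneg (hμ _)) (by simp [L])
    _ ≤ _ := by simp only [M]; linarith [show (0 : ℚ) ≤ (1 / 2) ^ (restrict Z L).length by positivity]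

/-! ### Traceability implies lowness -/

theorem mem_D {i e : ℕ} : i ∈ D e ↔ e.testBit i = true := by simp [D]

theorem D_sum (b : ℕ → Bool) (n : ℕ) :
    D (∑ y ∈ Finset.range n, bif b y then 2 ^ y else 0) = (Finset.range n).filter (b · = true) := by
  have : ∑ y ∈ Finset.range n, (bif b y then 2 ^ y else 0) =
      ∑ y ∈ (Finset.range n).filter (b · = true), 2 ^ y := by
    rw [Finset.sum_filter]
    refine Finset.sum_congr rfl fun y _ => ?_
    cases b y <;> rfl
  rw [this, D, Finset.toFinset_bitIndices_sum_two_pow]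

/-- The elements of a finite set given by its canonical index. -/
def listD (e : ℕ) : List ℕ := (List.range e).filter fun i => decide (e / 2 ^ i % 2 = 1)

theorem mem_listD {i e : ℕ} : i ∈ listD e ↔ i ∈ D e := by
  rw [mem_D, listD, List.mem_filter, List.mem_range, ← Nat.testBit_eq_decide_div_mod_eq,
    and_iff_right_iff_imp]
  exact fun h => Nat.lt_two_pow_self.trans_le (Nat.ge_two_pow_of_testBit h)

section

variable {α : Type} [Primcodable α] {O : Set (ℕ →. ℕ)}

@[fun_prop]
theorem computableIn_listD {f : α → ℕ} (hf : ComputableIn O f) :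
    ComputableIn O fun a => listD (f a) := by
  unfold listD
  fun_prop

theorem computableIn_sum_range {f : α → ℕ → ℕ} (hf : ComputableIn O fun p : α × ℕ => f p.1 p.2)
    {n : α → ℕ} (hn : ComputableIn O n) :
    ComputableIn O fun a => ∑ i ∈ Finset.range (n a), f a i := by
  have H : ComputableIn O fun a => Nat.rec (motive := fun _ => ℕ) 0 (fun i s => s + f a i) (n a) := by
    fun_prop
  refine H.of_eq fun a => congrArg Part.some ?_
  beta_reduce
  generalize n a = m
  induction m with
  | zero => rfl
  | succ m ih => rw [Finset.sum_range_succ, ← ih]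

theorem computableIn_contains [DecidableEq α] {β : Type} [Primcodable β] {l : β → List α} {x : β → α}
    (hl : ComputableIn O l) (hx : ComputableIn O x) :
    ComputableIn O fun b => (l b).any fun y => decide (y = x b) := by
  fun_prop

end

/-- The strings of the finite set coded by `c`, provided its measure is at most `2⁻ᵏ`. -/
def smallCode (c k : ℕ) : List Str :=
  (decode c : Option (List Str)).toList.flatMap fun S =>
    bif decide (vol S ≤ (1 / 2) ^ k) then S else []

theorem computableIn_smallCode {α : Type} [Primcodable α] {O : Set (ℕ →. ℕ)} {c k : α → ℕ}
    (hc : ComputableIn O c) (hk : ComputableIn O k) :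
    ComputableIn O fun a => smallCode (c a) (k a) := by
  have h : ComputableIn O fun p : α × List Str => decide (vol p.2 ≤ (1 / 2) ^ k p.1) :=
    (ratComputableIn_vol (by fun_prop)).decide_le (RatComputableIn.half_pow (by fun_prop))
  exact computableIn_flatMap (by fun_prop)
    (computableIn_cond h (by fun_prop) (by fun_prop))

theorem smallCode_encode {S : List Str} {k : ℕ} (h : lebesgue.real (cyl S) ≤ (1 / 2) ^ k) :
    smallCode (encode S) k = S := by
  have h' : vol S ≤ (1 / 2) ^ k := by
    rw [lebesgue_cyl] at h
    rw [← Rat.cast_le (K := ℝ)]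
    push_cast
    exact h
  simp [smallCode, encodek, -one_div]
  simp only [h', decide_true, cond_true]

/-- Holds for every number `c`, so the wrong guesses in a trace, which may code large sets or
nothing, do no harm. -/
theorem lebesgue_smallCode (c k : ℕ) : lebesgue.real (cyl (smallCode c k)) ≤ (1 / 2) ^ k := by
  unfold smallCode
  cases (decode c : Option (List Str)) with
  | none => simp
  | some S =>
    simp only [Option.toList_some, List.flatMap_cons, List.flatMap_nil, List.append_nil]
    by_cases h : vol S ≤ (1 / 2) ^ k
    · simp only [h, decide_true, cond_true]
      rw [lebesgue_cyl]
      rw [← Rat.cast_le (K := ℝ)] at h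
      push_cast at h
      exact h
    · simp only [h, decide_false, cond_false]
      simp

/-- The additional `p` in the exponent pays for the at most `p ≤ 2 ^ p` members of the trace. -/
theorem lebesgue_trace_le {T : Finset ℕ} {p : ℕ} (hT : T.card ≤ p) (n : ℕ) :
    lebesgue.real (⋃ c ∈ T, cyl (smallCode c (n + p))) ≤ (1 / 2) ^ n := by
  calc _ ≤ ∑ c ∈ T, lebesgue.real (cyl (smallCode c (n + p))) := measureReal_biUnion_finset_le _ _
    _ ≤ T.card • (1 / 2) ^ (n + p) := Finset.sum_le_card_nsmul _ _ _ fun c _ => lebesgue_smallCode _ _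
    _ ≤ 2 ^ p * (1 / 2) ^ (n + p) := by
      rw [nsmul_eq_mul]
      gcongr
      exact_mod_cast hT.trans Nat.lt_two_pow_self.le
    _ = (1 / 2) ^ n := by
      rw [pow_add, mul_comm, mul_assoc, ← mul_pow]; norm_num

/-- The clopen sets witnessing that `Z` is not Schnorr random in `A`, coded by numbers. -/
theorem exists_code_of_notMem_SR {A Z : BinSeq} (hZ : Z ∉ SR {toOracle A}) {p : ℕ → ℕ}
    (hp : Computable p) : ∃ f : ℕ → ℕ, ComputableIn {toOracle A} f ∧
      ∃ᶠ n in atTop, Z ∈ cyl (smallCode (f n) (n + p n)) := by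
  have hp' : ComputableIn {toOracle A} p := hp.computableIn
  obtain ⟨f, hf, hμ, hfZ⟩ := exists_clopen_of_notMem_SR (totalOracles_singleton A) hZ
    (ε := fun n => n + p n) (by fun_prop)
  refine ⟨fun n => encode (f n), by fun_prop, hfZ.mono fun n hn => ?_⟩
  rwa [smallCode_encode (hμ n)]

/-- The union over the whole trace is again a clopen set, computable without the oracle because the
trace is given by canonical indices. -/
theorem low_SR_SR_of_computablyTraceable {A : BinSeq} (hA : ComputablyTraceable A) :
    A ∈ Low SR SR := by
  intro Z hZ
  by_contra hZA
  obtain ⟨p, hp, hA⟩ := hA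
  obtain ⟨f, hf, hfZ⟩ := exists_code_of_notMem_SR hZA hp
  obtain ⟨r, hr, hfr⟩ := hA f hf
  rw [← computableIn_empty_iff] at hp hr
  refine notMem_SR_of_clopen (O := ∅)
    (f := fun n => (listD (r n)).flatMap fun c => smallCode c (n + p n)) ?_ (fun n => ?_)
    (hfZ.mono fun n hn => mem_cyl_flatMap.2 ⟨f n, mem_listD.2 (hfr n).2, hn⟩) hZ
  · exact computableIn_flatMap (by fun_prop) (computableIn_smallCode (by fun_prop) (by fun_prop))
  · refine (measureReal_mono (h₂ := measure_ne_top _ _) fun Z hZ => ?_).trans (lebesgue_trace_le (hfr n).1 n)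
    obtain ⟨c, hc, hcZ⟩ := mem_cyl_flatMap.1 hZ
    exact Set.mem_biUnion (mem_listD.1 hc) hcZ

theorem mem_W_iff {e y : ℕ} : y ∈ W e ↔
    ∃ t, (Nat.Partrec.Code.evaln t (Denumerable.ofNat Nat.Partrec.Code e) y).isSome = true := by
  simp only [W, Set.mem_ofPred_eq, Part.dom_iff_mem, Nat.Partrec.Code.evaln_complete,
    Option.isSome_iff_exists, Option.mem_def]
  exact exists_comm

/-- With an r.e. trace the union over its members can only be enumerated, so a Martin-Löf test takes
the place of the Schnorr test. -/
theorem low_MR_SR_of_reTraceable {A : BinSeq} (hA : RETraceable A) : A ∈ Low MR SR := by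
  intro Z hZ
  by_contra hZA
  obtain ⟨p, hp, hA⟩ := hA
  obtain ⟨f, hf, hfZ⟩ := exists_code_of_notMem_SR hZA hp
  obtain ⟨r, hr, hfr⟩ := hA f hf
  rw [← computableIn_empty_iff] at hp hr
  let V : ℕ × Str → Prop := fun q => ∃ c, c ∈ W (r q.1) ∧ q.2 ∈ smallCode c (q.1 + p q.1)
  have hsets : ∀ n, {Z | ∃ σ, V (n, σ) ∧ Z ∈ basicOpen σ} ⊆
      ⋃ c ∈ W (r n), cyl (smallCode c (n + p n)) := by
    rintro n Z ⟨σ, ⟨c, hc, hσ⟩, hZσ⟩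
    exact Set.mem_biUnion hc ⟨σ, hσ, hZσ⟩
  refine notMem_MR_of_sigma1 (V := V) totalOracles_empty ?_ (fun n => ?_) (hfZ.mono fun n hn => ?_) hZ
  · have hs : ComputableIn ∅ fun q : (ℕ × Str) × ℕ =>
        smallCode (Nat.unpair q.2).1 (q.1.1 + p q.1.1) :=
      computableIn_smallCode (by fun_prop) (by fun_prop)
    -- The witness `i` codes a member of the trace together with a stage at which it has been
    -- enumerated.
    refine (REPredIn.of_exists (R := fun (q : ℕ × Str) i =>
      (Nat.Partrec.Code.evaln (Nat.unpair i).2 (Denumerable.ofNat Nat.Partrec.Code (r q.1))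
        (Nat.unpair i).1).isSome &&
      (smallCode (Nat.unpair i).1 (q.1 + p q.1)).any fun y => decide (y = q.2))
      (computableIn_and (by fun_prop) (computableIn_contains hs (by fun_prop)))).of_iff fun q => ?_
    simp only [V, mem_W_iff, Bool.and_eq_true, List.any_eq_true, decide_eq_true_eq, exists_eq_right]
    constructor
    · rintro ⟨c, ⟨t, ht⟩, h⟩
      exact ⟨Nat.pair c t, by simpa using ht, by simpa using h⟩
    · rintro ⟨i, h1, h2⟩
      exact ⟨_, ⟨_, h1⟩, h2⟩
  · obtain ⟨hfin, hcard⟩ := Set.encard_le_coe_iff_finite_ncard_le.1 (hfr n).1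
    rw [Set.ncard_eq_toFinset_card _ hfin] at hcard
    refine (measureReal_mono (h₂ := measure_ne_top _ _) ((hsets n).trans ?_)).trans (lebesgue_trace_le hcard n)
    simp
  · obtain ⟨σ, hσ, hZσ⟩ := hn
    exact ⟨σ, ⟨f n, (hfr n).2, hσ⟩, hZσ⟩

/-! ### From r.e. traces to computable traces -/

/-- `A` is of hyperimmune-free degree: all functions computable in `A` are computably bounded. -/
def HyperimmuneFree (A : BinSeq) : Prop :=
  ∀ f : ℕ → ℕ, ComputableIn {toOracle A} f → ∃ h : ℕ → ℕ, Computable h ∧ ∀ n, f n ≤ h n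

/-- The oracle computes the stage at which `f x` appears in its trace. A computable bound `h` on
that stage allows the enumeration to be stopped at stage `h x`, leaving a finite set with a
computable canonical index. -/
theorem computablyTraceable_of_reTraceable {A : BinSeq} (hA : RETraceable A)
    (hif : HyperimmuneFree A) : ComputablyTraceable A := by
  obtain ⟨p, hp, hA⟩ := hA
  refine ⟨p, hp, fun f hf => ?_⟩
  obtain ⟨r, hr, hfr⟩ := hA f hf
  have hrA : ComputableIn {toOracle A} r := hr.computableIn
  have hex : ∀ x, ∃ t, (Nat.Partrec.Code.evaln t (Denumerable.ofNat Nat.Partrec.Code (r x))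
      (f x)).isSome = true := fun x => mem_W_iff.1 (hfr x).2
  obtain ⟨h, hh, hle⟩ := hif (fun x => Nat.find (hex x)) (computableIn_find
    (P := fun x t => (Nat.Partrec.Code.evaln t (Denumerable.ofNat Nat.Partrec.Code (r x))
      (f x)).isSome) (by fun_prop) hex)
  let b : ℕ → ℕ → Bool := fun x y =>
    (Nat.Partrec.Code.evaln (h x) (Denumerable.ofNat Nat.Partrec.Code (r x)) y).isSome
  refine ⟨fun x => ∑ y ∈ Finset.range (h x), bif b x y then 2 ^ y else 0, ?_, fun x => ?_⟩
  · rw [← computableIn_empty_iff] at hr hh ⊢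
    exact computableIn_sum_range (f := fun x y => bif b x y then 2 ^ y else 0) (by fun_prop) hh
  · rw [D_sum]
    constructor
    · obtain ⟨hfin, hcard⟩ := Set.encard_le_coe_iff_finite_ncard_le.1 (hfr x).1
      rw [Set.ncard_eq_toFinset_card _ hfin] at hcard
      refine (Finset.card_le_card fun y hy => ?_).trans hcard
      rw [Set.Finite.mem_toFinset, mem_W_iff]
      exact ⟨h x, (Finset.mem_filter.1 hy).2⟩
    · obtain ⟨y, hy⟩ := Option.isSome_iff_exists.1 (Nat.find_spec (hex x))
      -- A computation that halts within `h x` steps has its input below `h x`, so restricting the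
      -- trace to numbers below `h x` loses nothing.
      have hy' := Nat.Partrec.Code.evaln_mono (hle x) hy
      exact Finset.mem_filter.2 ⟨Finset.mem_range.2 (Nat.Partrec.Code.evaln_bound hy'),
        Option.isSome_iff_exists.2 ⟨y, hy'⟩⟩

/-! ### A `Σ⁰₁` class containing all non-random reals -/

/-- The stage `t` approximation of the component `e + 2` of the `e`th candidate test. -/
def candidateStage (e t : ℕ) : List Str :=
  ((List.range t).flatMap allStr).filter fun σ => (Nat.Partrec.Code.evaln t
    (Denumerable.ofNat Nat.Partrec.Code e) (encode ((e + 2, σ) : ℕ × Str))).isSome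

theorem mem_candidateStage {e t : ℕ} {σ : Str} : σ ∈ candidateStage e t ↔ σ.length < t ∧
    (Nat.Partrec.Code.evaln t (Denumerable.ofNat Nat.Partrec.Code e)
      (encode ((e + 2, σ) : ℕ × Str))).isSome = true := by
  simp [candidateStage, mem_allStr]

theorem candidateStage_subset {e s t : ℕ} (h : s ≤ t) :
    candidateStage e s ⊆ candidateStage e t := by
  intro σ
  simp only [mem_candidateStage, Option.isSome_iff_exists]
  rintro ⟨h1, y, hy⟩
  exact ⟨h1.trans_le h, y, Nat.Partrec.Code.evaln_mono h hy⟩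

/-- The approximation `candidateStage e t`, discarded when its measure exceeds `2⁻⁽ᵉ⁺²⁾`. -/
def trimmedStage (e t : ℕ) : List Str :=
  bif decide (vol (candidateStage e t) ≤ (1 / 2) ^ (e + 2)) then candidateStage e t else []

theorem trimmedStage_of_le {e t : ℕ}
    (h : lebesgue.real (cyl (candidateStage e t)) ≤ (1 / 2) ^ (e + 2)) :
    trimmedStage e t = candidateStage e t := by
  have h' : vol (candidateStage e t) ≤ (1 / 2) ^ (e + 2) := by
    rw [← Rat.cast_le (K := ℝ), ← lebesgue_cyl]
    push_cast
    exact h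
  simp only [trimmedStage, h', decide_true, cond_true]

theorem trimmedStage_of_lt {e t : ℕ}
    (h : (1 / 2) ^ (e + 2) < lebesgue.real (cyl (candidateStage e t))) :
    trimmedStage e t = [] := by
  have h' : ¬ vol (candidateStage e t) ≤ (1 / 2) ^ (e + 2) := by
    rw [not_le, ← Rat.cast_lt (K := ℝ), ← lebesgue_cyl]
    push_cast
    exact h
  simp only [trimmedStage, h', decide_false, cond_false]

theorem lebesgue_trimmedStage_le (e t : ℕ) :
    lebesgue.real (cyl (trimmedStage e t)) ≤ (1 / 2) ^ (e + 2) := by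
  rcases le_or_gt (lebesgue.real (cyl (candidateStage e t))) ((1 / 2) ^ (e + 2)) with h | h
  · rwa [trimmedStage_of_le h]
  · rw [trimmedStage_of_lt h]
    simp

/-- The trimmed stages are not monotone: they grow while the measure bound holds and are empty from
the stage at which it fails. Directedness survives and suffices to make the measure of the union the
supremum of the measures. -/
theorem directed_trimmedStage (e : ℕ) : Directed (· ⊆ ·) fun t => cyl (trimmedStage e t) := by
  have key : ∀ s t, s ≤ t → ∃ u, cyl (trimmedStage e s) ⊆ cyl (trimmedStage e u) ∧
      cyl (trimmedStage e t) ⊆ cyl (trimmedStage e u) := by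
    intro s t hst
    rcases le_or_gt (lebesgue.real (cyl (candidateStage e t))) ((1 / 2) ^ (e + 2)) with h | h
    · refine ⟨t, cyl_mono ?_, subset_rfl⟩
      rw [trimmedStage_of_le h, trimmedStage_of_le
        ((measureReal_mono (cyl_mono (candidateStage_subset hst))).trans h)]
      exact candidateStage_subset hst
    · refine ⟨s, subset_rfl, ?_⟩
      rw [trimmedStage_of_lt h]
      simp
  intro s t
  rcases le_total s t with h | h
  · exact key s t h
  · obtain ⟨u, h1, h2⟩ := key t s h
    exact ⟨u, h2, h1⟩

theorem computableIn_trimmedStage {O : Set (ℕ →. ℕ)} :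
    ComputableIn O fun p : ℕ × ℕ => trimmedStage p.1 p.2 := by
  have h1 : ComputableIn O fun p : ℕ × ℕ => candidateStage p.1 p.2 := by
    unfold candidateStage
    fun_prop
  have h2 : ComputableIn O fun p : ℕ × ℕ =>
      decide (vol (candidateStage p.1 p.2) ≤ (1 / 2) ^ (p.1 + 2)) :=
    (ratComputableIn_vol h1).decide_le (RatComputableIn.half_pow (by fun_prop))
  exact computableIn_cond h2 h1 (by fun_prop)

/-- There is a `Σ⁰₁` class of measure at most `1 / 2` containing all reals that are not
Martin-Löf random. -/
theorem exists_universal : ∃ G : ℕ → List Str, ComputableIn ∅ G ∧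
    lebesgue.real (⋃ i, cyl (G i)) ≤ 1 / 2 ∧ ∀ Z, Z ∉ MR ∅ → Z ∈ ⋃ i, cyl (G i) := by
  refine ⟨fun i => trimmedStage i.unpair.1 i.unpair.2,
    computableIn_comp (g := Nat.unpair) computableIn_trimmedStage (by fun_prop), ?_, fun Z hZ => ?_⟩
  · have hsub : (⋃ i : ℕ, cyl (trimmedStage i.unpair.1 i.unpair.2)) ⊆
        ⋃ e, ⋃ t, cyl (trimmedStage e t) := by
      refine Set.iUnion_subset fun i => ?_
      exact Set.subset_iUnion_of_subset i.unpair.1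
        (Set.subset_iUnion (fun t => cyl (trimmedStage i.unpair.1 t)) i.unpair.2)
    -- The candidate `e` contributes at most `2⁻⁽ᵉ⁺²⁾`, and these bounds add up to `1 / 2`.
    have h := lebesgue_iUnion_le (n := 1) (E := fun e => ⋃ t, cyl (trimmedStage e t)) fun e => by
      rw [measureReal_def, (directed_trimmedStage e).measure_iUnion]
      refine ENNReal.toReal_le_of_le_ofReal (by positivity) (iSup_le fun t => ?_)
      rw [← ofReal_measureReal]
      refine ENNReal.ofReal_le_ofReal ?_
      rw [show 1 + 1 + e = e + 2 by omega]
      exact lebesgue_trimmedStage_le e t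
    simpa using (measureReal_mono hsub).trans h
  · simp only [MR, Set.mem_ofPred_eq, not_forall, not_exists, not_not] at hZ
    obtain ⟨U, ⟨⟨W, hW, hU⟩, hμ⟩, hZU⟩ := hZ
    obtain ⟨c, hc⟩ := Nat.Partrec.Code.exists_code.1 (recursiveIn_empty_iff.1 hW)
    have hdom : ∀ p : ℕ × Str, W p ↔ ∃ t, (Nat.Partrec.Code.evaln t c (encode p)).isSome = true := by
      intro p
      have h1 : (c.eval (encode p)).Dom ↔ W p := by
        rw [hc]
        simp [Part.dom_iff_mem, Part.mem_assert_iff]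
      rw [← h1, Part.dom_iff_mem]
      simp only [Nat.Partrec.Code.evaln_complete, Option.isSome_iff_exists, Option.mem_def]
      exact exists_comm
    set e := encode c with he
    have hec : Denumerable.ofNat Nat.Partrec.Code e = c := by simp [he]
    -- The component is chosen from the code of the test itself. A genuine test satisfies the bound
    -- there, so its approximations are never discarded.
    have hZe := hZU (e + 2)
    rw [hU] at hZe
    obtain ⟨σ, hσ, hZσ⟩ := hZe
    obtain ⟨t, ht⟩ := (hdom _).1 hσ
    obtain ⟨y, hy⟩ := Option.isSome_iff_exists.1 ht
    have hmem : σ ∈ candidateStage e (max t (σ.length + 1)) :=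
      mem_candidateStage.2 ⟨by omega, by
        rw [hec]
        exact Option.isSome_iff_exists.2 ⟨y, Nat.Partrec.Code.evaln_mono (le_max_left _ _) hy⟩⟩
    have hsub : cyl (candidateStage e (max t (σ.length + 1))) ⊆ U (e + 2) := by
      rintro Y ⟨τ, hτ, hY⟩
      rw [mem_candidateStage, hec] at hτ
      rw [hU]
      exact ⟨τ, (hdom _).2 ⟨_, hτ.2⟩, hY⟩
    refine Set.mem_iUnion.2 ⟨Nat.pair e (max t (σ.length + 1)), ?_⟩
    beta_reduce
    rw [Nat.unpair_pair, trimmedStage_of_le ((measureReal_mono hsub).trans (hμ _))]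
    exact ⟨σ, hmem, hZσ⟩

/-! ### Lowness for Martin-Löf versus Schnorr randomness gives r.e. traces -/

/-- The reals with ones at the `k` positions of the block with index `(k, l)`. -/
def block (k l : ℕ) : Set BinSeq := {Z | ∀ i < k, Z (Nat.pair (Nat.pair k l) i) = true}

/-- A list of strings generating `block k l`. -/
def blockList (k l : ℕ) : List Str :=
  -- Pairing increases in its second argument, so this length exceeds all positions of the block.
  (allStr (Nat.pair (Nat.pair k l) k)).filter fun τ =>
    (List.range k).all fun i => decide (τ[Nat.pair (Nat.pair k l) i]? = some true)

@[fun_prop]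
theorem computableIn_blockList {α : Type} [Primcodable α] {O : Set (ℕ →. ℕ)} {f g : α → ℕ}
    (hf : ComputableIn O f) (hg : ComputableIn O g) :
    ComputableIn O fun a => blockList (f a) (g a) := by
  unfold blockList
  fun_prop

theorem mem_cyl_filter_allStr {q : Str → Bool} {n : ℕ} {Z : BinSeq} :
    Z ∈ cyl ((allStr n).filter q) ↔ q (restrict Z n) = true := by
  constructor
  · rintro ⟨τ, hτ, hZ⟩
    rw [List.mem_filter, mem_allStr] at hτ
    rw [mem_basicOpen, hτ.1] at hZ
    rw [hZ]
    exact hτ.2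
  · exact fun h => ⟨restrict Z n, List.mem_filter.2 ⟨mem_allStr.2 (by simp), h⟩, by simp⟩

theorem cyl_blockList (k l : ℕ) : cyl (blockList k l) = block k l := by
  ext Z
  rw [blockList, mem_cyl_filter_allStr]
  simp only [List.all_eq_true, List.mem_range, decide_eq_true_eq, block, Set.mem_ofPred_eq]
  refine forall₂_congr fun i hi => ?_
  have := Nat.pair_lt_pair_right (Nat.pair k l) hi
  simp [restrict, this]

theorem measurableSet_block (k l : ℕ) : MeasurableSet (block k l) := by
  rw [← cyl_blockList]
  exact measurableSet_cyl _

/-- Blocks with the same `k` and different `l` use disjoint sets of coordinates and are therefore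
independent. Formally, selecting these coordinates and currying turns the measure into a product
over `l` of uniform measures on `k` bits, and the intersection into a box. -/
theorem lebesgue_iInter_block_compl (k : ℕ) (T : Finset ℕ) :
    lebesgue.real (⋂ l ∈ T, (block k l)ᶜ) = (1 - (1 / 2) ^ k) ^ T.card := by
  let P : Measure Bool := (PMF.uniformOfFintype Bool).toMeasure
  let e : ℕ × Fin k → ℕ := fun p => Nat.pair (Nat.pair k p.1) p.2
  have he : Function.Injective e := by
    rintro ⟨a, i⟩ ⟨b, j⟩ h
    simpa [e, Nat.pair_eq_pair, Fin.ext_iff] using h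
  have h1 : lebesgue.map (fun Z p => Z (e p)) = Measure.infinitePi fun _ : ℕ × Fin k => P :=
    Measure.map_infinitePi_infinitePi_of_inj (P := fun _ : ℕ => P) he
  have h2 := Measure.infinitePi_map_curry (fun (_ : ℕ) (_ : Fin k) => P)
  rw [← h1, Measure.map_map (by fun_prop) (by fun_prop)] at h2
  let t : Set (Fin k → Bool) := {fun _ => true}ᶜ
  have ht : MeasurableSet t := (measurableSet_singleton _).compl
  have h3 : (⋂ l ∈ T, (block k l)ᶜ) =
      (MeasurableEquiv.curry ℕ (Fin k) Bool ∘ fun (Z : BinSeq) p => Z (e p)) ⁻¹'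
        Set.pi T fun _ => t := by
    ext Z
    simp only [Set.mem_iInter, Set.mem_compl_iff, block, Set.mem_ofPred_eq, Set.mem_preimage,
      Set.mem_pi, t, Set.mem_singleton_iff, Function.comp_apply, funext_iff, Fin.forall_iff]
    rfl
  have h4 : Measure.infinitePi (fun _ : Fin k => P) t = 1 - (1 / 2) ^ k := by
    rw [prob_compl_eq_one_sub (measurableSet_singleton _), Measure.infinitePi_singleton]
    simp [P]
  rw [measureReal_def, h3, ← Measure.map_apply (by fun_prop)
    (MeasurableSet.pi (Finset.countable_toSet _) fun _ _ => ht), h2,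
    Measure.infinitePi_pi _ fun _ _ => ht]
  simp only [h4, Finset.prod_const, ENNReal.toReal_pow]
  rw [ENNReal.toReal_sub_of_le (by exact pow_le_one₀ (by simp) (by simp)) (by simp)]
  simp

theorem lebesgue_block (k l : ℕ) : lebesgue.real (block k l) = (1 / 2) ^ k := by
  have h := lebesgue_iInter_block_compl k {l}
  simp only [Finset.mem_singleton, Set.iInter_iInter_eq_left, Finset.card_singleton, pow_one] at h
  rw [measureReal_compl (measurableSet_block k l), probReal_univ] at h
  linarith

theorem exists_limit {σ : ℕ → Str} (h : ∀ n, σ n <+: σ (n + 1))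
    (hlt : ∀ n, (σ n).length < (σ (n + 1)).length) :
    (∀ n, n ≤ (σ n).length) ∧ ∃ Z : BinSeq, ∀ n, Z ∈ basicOpen (σ n) := by
  have hlen : ∀ n, n ≤ (σ n).length := by
    intro n
    induction n with
    | zero => exact Nat.zero_le _
    | succ n ih => exact (Nat.succ_le_succ ih).trans (hlt n)
  have hpre : ∀ m n, m ≤ n → σ m <+: σ n := by
    intro m n hmn
    induction n, hmn using Nat.le_induction with
    | base => exact List.prefix_rfl
    | succ n _ ih => exact ih.trans (h n)
  have hget : ∀ m n i, m ≤ n → i < (σ m).length → (σ n).getD i false = (σ m).getD i false := by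
    intro m n i hmn hi
    obtain ⟨ρ, hρ⟩ := hpre m n hmn
    rw [← hρ, List.getD_append _ _ _ _ hi]
  refine ⟨hlen, fun i => (σ (i + 1)).getD i false, fun n => ?_⟩
  rw [mem_basicOpen_iff_forall]
  intro i hi
  rcases le_total n (i + 1) with hn | hn
  · exact hget _ _ _ hn hi
  · exact (hget _ _ _ hn (hlen (i + 1))).symm

/-- If the limit superior of a sequence of clopen sets lies in an open set of measure less than
one, then some nonnull part of the complement almost avoids a tail of the sequence. -/
theorem exists_avoiding {G c : ℕ → List Str} (hG : lebesgue.real (⋃ i, cyl (G i)) < 1)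
    (h : ∀ Z, (∃ᶠ k in atTop, Z ∈ cyl (c k)) → Z ∈ ⋃ i, cyl (G i)) :
    ∃ σ n, 0 < lebesgue.real (basicOpen σ \ ⋃ i, cyl (G i)) ∧
      ∀ k, n < k → lebesgue.real ((basicOpen σ ∩ cyl (c k)) \ ⋃ i, cyl (G i)) = 0 := by
  set V := ⋃ i, cyl (G i) with hV
  -- A category argument on the complement of `V`. Otherwise each string with nonnull trace on this
  -- complement extends to another one whose cylinder lies in `cyl (c k)` for some late `k`. The
  -- limit enters infinitely many of these sets, hence the open set `V`; but then some cylinder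
  -- along the way is contained in `V`.
  by_contra! hcon
  have hVm : MeasurableSet V := MeasurableSet.iUnion fun i => measurableSet_cyl _
  have step : ∀ (n : ℕ) (s : {σ : Str // 0 < lebesgue.real (basicOpen σ \ V)}),
      ∃ r : {σ : Str // 0 < lebesgue.real (basicOpen σ \ V)},
        s.1 <+: r.1 ∧ s.1.length < r.1.length ∧ ∃ k, n < k ∧ basicOpen r.1 ⊆ cyl (c k) := by
    rintro n ⟨σ, hσ⟩
    obtain ⟨k, hk, hne⟩ := hcon σ n hσ
    -- Long enough for a proper extension of `σ` and for a cylinder meeting `cyl (c k)` to be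
    -- contained in it.
    set L := max (σ.length + 1) (c k).flatten.length with hL
    have hcov : (basicOpen σ ∩ cyl (c k)) \ V ⊆ ⋃ ρ ∈ (allStr L).toFinset,
        ((basicOpen σ ∩ cyl (c k)) \ V) ∩ basicOpen ρ := by
      intro Z hZ
      refine Set.mem_biUnion (x := restrict Z L) ?_ ⟨hZ, by simp⟩
      simp [mem_allStr]
    have hex : ∃ ρ ∈ (allStr L).toFinset,
        lebesgue.real (((basicOpen σ ∩ cyl (c k)) \ V) ∩ basicOpen ρ) ≠ 0 := by
      by_contra! hzero
      refine hne (le_antisymm ?_ measureReal_nonneg)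
      refine (measureReal_mono hcov (measure_ne_top _ _)).trans
        ((measureReal_biUnion_finset_le _ _).trans (Finset.sum_eq_zero hzero).le)
    obtain ⟨ρ, hρ, hρne⟩ := hex
    have hρL : ρ.length = L := by simpa [mem_allStr] using hρ
    have hnonempty : (((basicOpen σ ∩ cyl (c k)) \ V) ∩ basicOpen ρ).Nonempty := by
      by_contra hem
      rw [Set.not_nonempty_iff_eq_empty] at hem
      simp [hem] at hρne
    obtain ⟨Z, ⟨⟨hZσ, τ, hτ, hZτ⟩, -⟩, hZρ⟩ := hnonempty
    have hρZ : ρ = restrict Z L := by rw [← hρL, mem_basicOpen.1 hZρ]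
    have hτL : τ.length ≤ L := (length_le_length_flatten hτ).trans (le_max_right _ _)
    have hσρ : σ <+: ρ := by
      rw [hρZ]
      exact (mem_basicOpen_iff_prefix (by omega)).1 hZσ
    have hτρ : τ <+: ρ := by
      rw [hρZ]
      exact (mem_basicOpen_iff_prefix hτL).1 hZτ
    refine ⟨⟨ρ, ?_⟩, hσρ, ?_, k, hk, fun Y hY => ⟨τ, hτ, basicOpen_anti hτρ hY⟩⟩
    · refine lt_of_lt_of_le (lt_of_le_of_ne measureReal_nonneg hρne.symm) (measureReal_mono ?_)
      exact fun Y hY => ⟨hY.2, hY.1.2⟩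
    · simp only [hρL]
      omega
  choose next hnext1 hnext2 hnext3 using step
  have h0 : 0 < lebesgue.real (basicOpen [] \ V) := by
    rw [basicOpen_nil, ← Set.compl_eq_univ_sdiff, measureReal_compl hVm, probReal_univ]
    linarith
  let s : ℕ → {σ : Str // 0 < lebesgue.real (basicOpen σ \ V)} := fun n =>
    Nat.rec (motive := fun _ => {σ : Str // 0 < lebesgue.real (basicOpen σ \ V)}) ⟨[], h0⟩ next n
  have hs : ∀ n, s (n + 1) = next n (s n) := fun n => rfl
  obtain ⟨hlen, Z, hZ⟩ := exists_limit (σ := fun n => (s n).1)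
    (fun n => by rw [hs]; exact hnext1 _ _) (fun n => by rw [hs]; exact hnext2 _ _)
  have hZV : Z ∈ V := by
    refine h Z (frequently_atTop.2 fun n => ?_)
    obtain ⟨k, hk, hsub⟩ := hnext3 n (s n)
    exact ⟨k, hk.le, hsub (hs n ▸ hZ (n + 1))⟩
  obtain ⟨i, τ, hτ, hZτ⟩ := Set.mem_iUnion.1 hZV
  have hpos := (s τ.length).2
  have hsub : basicOpen (s τ.length).1 ⊆ V := by
    refine (basicOpen_anti ?_).trans fun Y hY => Set.mem_iUnion.2 ⟨i, τ, hτ, hY⟩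
    have h1 := (mem_basicOpen_iff_prefix (hlen τ.length)).1 hZτ
    rwa [mem_basicOpen.1 (hZ τ.length)] at h1
  rw [Set.sdiff_eq_empty.2 hsub] at hpos
  simp at hpos

/-- The sections of an r.e. relation are uniformly r.e. -/
theorem exists_index {P : ℕ × ℕ → Prop} (hP : REPredIn ∅ P) :
    ∃ r : ℕ → ℕ, Computable r ∧ ∀ k l, l ∈ W (r k) ↔ P (k, l) := by
  obtain ⟨c, hc⟩ := Nat.Partrec.Code.exists_code.1 (recursiveIn_empty_iff.1 hP)
  refine ⟨fun k => encode (c.curry k), ?_, fun k l => ?_⟩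
  · exact (Primrec.encode.comp (Nat.Partrec.Code.primrec₂_curry.comp (Primrec.const c)
      Primrec.id)).to_comp
  · simp only [W, Denumerable.ofNat_encode, Nat.Partrec.Code.eval_curry, Set.mem_ofPred_eq, hc]
    rw [show Nat.pair k l = encode ((k, l) : ℕ × ℕ) from rfl, encodek]
    simp [Part.dom_iff_mem, Part.mem_assert_iff]

/-- Bernoulli's inequality for `(1 + x) ^ N`, combined with `(1 - x)(1 + x) ≤ 1`. -/
theorem card_le_of_le_pow {x δ : ℝ} (hx0 : 0 ≤ x) (hx1 : x ≤ 1) (hδ : 0 < δ) {N : ℕ}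
    (h : δ ≤ (1 - x) ^ N) : N * x * δ ≤ 1 := by
  have h1 : 1 + N * x ≤ (1 + x) ^ N := one_add_mul_le_pow (by linarith) N
  have h2 : (1 - x) ^ N * (1 + x) ^ N ≤ 1 := by
    rw [← mul_pow]
    exact pow_le_one₀ (by nlinarith) (by nlinarith)
  have h3 : 0 ≤ N * x := by positivity
  calc N * x * δ ≤ (1 + N * x) * δ := by nlinarith
    _ ≤ (1 + x) ^ N * (1 - x) ^ N := by gcongr
    _ ≤ 1 := by linarith

/-- Only few of the blocks with first index `k` can almost avoid a set of positive measure. -/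
theorem card_le_of_almost_avoiding {Q : Set BinSeq} {d k : ℕ}
    (hd : (1 / 2) ^ d ≤ lebesgue.real Q) (hk : d + 1 ≤ k) {T : Finset ℕ}
    (hT : ∀ l ∈ T, lebesgue.real (Q ∩ block k l) ≤ (1 / 2) ^ (d + l + 2)) : T.card ≤ 4 ^ k := by
  -- A point of `Q` misses all blocks from `T`, which by independence has probability `(1 - 2⁻ᵏ) ^
  -- T.card`, or it lies in one of the small intersections. The latter have total measure at most
  -- `2⁻⁽ᵈ⁺¹⁾`, so the former must account for at least half of `2⁻ᵈ`.
  have hcov : Q ⊆ (⋂ l ∈ T, (block k l)ᶜ) ∪ ⋃ l ∈ T, Q ∩ block k l := by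
    intro Z hZ
    by_cases h : ∃ l ∈ T, Z ∈ block k l
    · obtain ⟨l, hl, h⟩ := h
      exact Or.inr (Set.mem_biUnion hl ⟨hZ, h⟩)
    · push Not at h
      exact Or.inl (by simpa using h)
  have h1 := (measureReal_mono (μ := lebesgue) hcov).trans (measureReal_union_le _ _)
  rw [lebesgue_iInter_block_compl] at h1
  have h2 : lebesgue.real (⋃ l ∈ T, Q ∩ block k l) ≤ (1 / 2) ^ (d + 1) := by
    refine (measureReal_biUnion_finset_le _ _).trans ((Finset.sum_le_sum hT).trans ?_)
    have hs : HasSum (fun l : ℕ => (1 / 2 : ℝ) ^ (d + l + 2)) ((1 / 2) ^ (d + 1)) := by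
      convert hasSum_geometric_two' ((1 / 2 : ℝ) ^ (d + 1)) using 2 with j
      rw [show d + j + 2 = (d + 1) + 1 + j by omega, pow_add, pow_succ]
      simp
      ring
    exact sum_le_hasSum T (fun _ _ => by positivity) hs
  have h3 : ((1 / 2 : ℝ)) ^ d = 2 * (1 / 2) ^ (d + 1) := by rw [pow_succ]; ring
  have h4 := card_le_of_le_pow (x := (1 / 2 : ℝ) ^ k) (δ := (1 / 2) ^ (d + 1)) (N := T.card)
    (by positivity) (pow_le_one₀ (by norm_num) (by norm_num)) (by positivity) (by linarith)
  -- From `d < k` the constant `d` is absorbed, leaving a bound that depends on `k` only and serves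
  -- as the same trace bound for all functions.
  have h5 : (1 / 4 : ℝ) ^ k ≤ (1 / 2) ^ k * (1 / 2) ^ (d + 1) := by
    rw [show (1 / 4 : ℝ) = 1 / 2 * (1 / 2) by norm_num, mul_pow]
    gcongr ?_ * ?_
    exact pow_le_pow_of_le_one (by norm_num) (by norm_num) hk
  have h6 : (T.card : ℝ) * (1 / 4) ^ k ≤ 1 := by
    refine le_trans ?_ h4
    rw [mul_assoc]
    gcongr
  have h7 : (T.card : ℝ) ≤ 4 ^ k := by
    rw [one_div, inv_pow, mul_inv_le_iff₀ (by positivity), one_mul] at h6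
    exact h6
  exact_mod_cast h7

/-- The indices `l` such that at some stage `block k l` is seen to almost avoid the complement of
`⋃ i, cyl (G i)` inside `basicOpen σ`. -/
def traceSet (G : ℕ → List Str) (σ : Str) (d k : ℕ) : Set ℕ :=
  {l | ∃ s, decide (vol (diff (inter [σ] (blockList k l)) ((List.range s).flatMap G)) <
    (1 / 2) ^ (d + l + 2)) = true}

theorem mem_traceSet {G : ℕ → List Str} {σ : Str} {d k l : ℕ} : l ∈ traceSet G σ d k ↔
    ∃ s, lebesgue.real ((basicOpen σ ∩ block k l) \ cyl ((List.range s).flatMap G)) <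
      (1 / 2) ^ (d + l + 2) := by
  simp only [traceSet, Set.mem_ofPred_eq, decide_eq_true_eq]
  refine exists_congr fun s => ?_
  rw [← Rat.cast_lt (K := ℝ), ← lebesgue_cyl, cyl_diff, cyl_inter, cyl_singleton, cyl_blockList]
  push_cast
  rfl

theorem cyl_flatMap_range_subset (G : ℕ → List Str) (s : ℕ) :
    cyl ((List.range s).flatMap G) ⊆ ⋃ i, cyl (G i) := by
  intro Z hZ
  obtain ⟨i, -, h⟩ := mem_cyl_flatMap.1 hZ
  exact Set.mem_iUnion.2 ⟨i, h⟩

theorem lebesgue_lt_of_mem_traceSet {G : ℕ → List Str} {σ : Str} {d k l : ℕ}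
    (h : l ∈ traceSet G σ d k) :
    lebesgue.real ((basicOpen σ \ ⋃ i, cyl (G i)) ∩ block k l) < (1 / 2) ^ (d + l + 2) := by
  obtain ⟨s, hs⟩ := mem_traceSet.1 h
  refine lt_of_le_of_lt (measureReal_mono ?_) hs
  rintro Z ⟨⟨h1, h2⟩, h3⟩
  exact ⟨⟨h1, h3⟩, fun h => h2 (cyl_flatMap_range_subset G s h)⟩

/-- The finite stages decrease to a null set, so by continuity from above one of them has measure
below the positive threshold. Asking for this instead of measure zero is what makes the trace r.e.
-/
theorem mem_traceSet_of_lebesgue_eq_zero {G : ℕ → List Str} {σ : Str} {d k l : ℕ}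
    (h : lebesgue.real ((basicOpen σ ∩ block k l) \ ⋃ i, cyl (G i)) = 0) :
    l ∈ traceSet G σ d k := by
  have hanti : Antitone fun s =>
      (basicOpen σ ∩ block k l) \ cyl ((List.range s).flatMap G) := by
    intro s t hst
    refine Set.sdiff_subset_sdiff_right fun Z hZ => ?_
    obtain ⟨i, hi, hZi⟩ := mem_cyl_flatMap.1 hZ
    exact mem_cyl_flatMap.2 ⟨i, List.mem_range.2 ((List.mem_range.1 hi).trans_le hst), hZi⟩
  have heq : (⋂ s, (basicOpen σ ∩ block k l) \ cyl ((List.range s).flatMap G)) =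
      (basicOpen σ ∩ block k l) \ ⋃ i, cyl (G i) := by
    ext Z
    simp only [Set.mem_iInter, Set.mem_sdiff, mem_cyl_flatMap, List.mem_range, Set.mem_iUnion,
      not_exists, not_and]
    exact ⟨fun h => ⟨(h 0).1, fun i => (h (i + 1)).2 i (Nat.lt_succ_self i)⟩,
      fun h s => ⟨h.1, fun i _ => h.2 i⟩⟩
  have ht := (ENNReal.tendsto_toReal (measure_ne_top lebesgue _)).comp
    (tendsto_measure_iInter_atTop (μ := lebesgue) (fun s => (((measurableSet_basicOpen σ).inter
      (measurableSet_block k l)).diff (measurableSet_cyl _)).nullMeasurableSet) hanti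
      ⟨0, measure_ne_top _ _⟩)
  rw [heq, ← measureReal_def, h] at ht
  obtain ⟨s, hs⟩ := (ht.eventually (gt_mem_nhds (show (0 : ℝ) < (1 / 2) ^ (d + l + 2) by
    positivity))).exists
  exact mem_traceSet.2 ⟨s, hs⟩

/-- A real in infinitely many `block k (f k)` is not Schnorr random in `A`, hence not Martin-Löf
random, hence in the class generated by `G`. So `f k` is among the few `l` for which `block k l`
almost misses the nonnull set provided by `exists_avoiding`. -/
theorem reTraceable_of_low_MR_SR {A : BinSeq} (hA : A ∈ Low MR SR) : RETraceable A := by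
  refine ⟨fun k => 4 ^ k, computableIn_empty_iff.1 (by fun_prop), fun f hf => ?_⟩
  obtain ⟨G, hG, hG1, hGMR⟩ := exists_universal
  obtain ⟨σ, n, hpos, havoid⟩ := exists_avoiding (c := fun k => blockList k (f k))
    (lt_of_le_of_lt hG1 (by norm_num)) fun Z hZ => hGMR Z fun hMR =>
      notMem_SR_of_clopen (f := fun k => blockList k (f k)) (by fun_prop)
        (fun k => by rw [cyl_blockList, lebesgue_block]) hZ (hA hMR)
  obtain ⟨d, hd⟩ := exists_pow_lt_of_lt_one hpos (show (1 / 2 : ℝ) < 1 by norm_num)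
  -- Beyond `K` both the avoidance (`n < k`) and the counting bound (`d + 1 ≤ k`) apply. The
  -- finitely many values up to `K` are stored in `L` and traced by singletons.
  set K := max n d with hK
  let L := (List.range (K + 1)).map f
  have hL : ∀ k l, L[k]? = some l ↔ k ≤ K ∧ f k = l := by
    intro k l
    simp only [L, List.getElem?_map, Option.map_eq_some_iff, List.getElem?_eq_some_iff]
    simp
  let R : ℕ × ℕ → ℕ → Bool := fun p s => decide (L[p.1]? = some p.2) || (decide (K < p.1) &&
    decide (vol (diff (inter [σ] (blockList p.1 p.2)) ((List.range s).flatMap G)) <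
      (1 / 2) ^ (d + p.2 + 2)))
  have hR : ComputableIn ∅ fun q : (ℕ × ℕ) × ℕ => R q.1 q.2 := by
    have h1 : ComputableIn ∅ fun q : (ℕ × ℕ) × ℕ =>
        decide (vol (diff (inter [σ] (blockList q.1.1 q.1.2)) ((List.range q.2).flatMap G)) <
          (1 / 2) ^ (d + q.1.2 + 2)) :=
      (ratComputableIn_vol (by fun_prop)).decide_lt (RatComputableIn.half_pow (by fun_prop))
    exact computableIn_or (computableIn_decide_eq (by fun_prop) (by fun_prop))
      (computableIn_and (computableIn_decide_lt (by fun_prop) (by fun_prop)) h1)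
  obtain ⟨r, hr, hrW⟩ := exists_index (REPredIn.of_exists hR)
  have hmem : ∀ k l, l ∈ W (r k) ↔ (k ≤ K ∧ f k = l) ∨ (K < k ∧ l ∈ traceSet G σ d k) := by
    intro k l
    rw [hrW]
    simp only [R, Bool.or_eq_true, Bool.and_eq_true, decide_eq_true_eq (p := K < k), hL, exists_or, exists_const, exists_and_left]
    exact or_congr_left decide_eq_true_iff
  refine ⟨r, hr, fun k => ⟨?_, ?_⟩⟩
  · rcases le_or_gt k K with hk | hk
    · have : W (r k) ⊆ {f k} := by
        intro l hl
        rcases (hmem k l).1 hl with h | h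
        · exact h.2.symm
        · omega
      refine (Set.encard_le_encard this).trans ?_
      rw [Set.encard_singleton]
      exact_mod_cast Nat.one_le_pow _ _ (by norm_num)
    · by_contra! hcon
      have hcon' : ((4 ^ k + 1 : ℕ) : ℕ∞) ≤ (W (r k)).encard := by
        push_cast at hcon ⊢
        exact Order.add_one_le_of_lt hcon
      obtain ⟨T, hTW, hT⟩ := Set.exists_subset_encard_eq hcon'
      have hfin : T.Finite := Set.finite_of_encard_eq_coe hT
      have hcard : hfin.toFinset.card = 4 ^ k + 1 := by
        rw [hfin.encard_eq_coe_toFinset_card] at hT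
        exact_mod_cast hT
      have := card_le_of_almost_avoiding (T := hfin.toFinset) (k := k) (d := d)
        hd.le (by omega) fun l hl => by
          rcases (hmem k l).1 (hTW (hfin.mem_toFinset.1 hl)) with h | h
          · omega
          · exact (lebesgue_lt_of_mem_traceSet h.2).le
      omega
  · rw [hmem]
    rcases le_or_gt k K with hk | hk
    · exact Or.inl ⟨hk, rfl⟩
    · refine Or.inr ⟨hk, mem_traceSet_of_lebesgue_eq_zero ?_⟩
      have := havoid k (by omega)
      rwa [cyl_blockList] at this

/-! ### Lowness for computable versus Schnorr randomness gives computable bounds -/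

/-- Extend `σ` by `m` bits, following the choice function `d`. -/
def follow (d : Str → Bool) (m : ℕ) (σ : Str) : Str :=
  Nat.rec (motive := fun _ => Str) σ (fun _ τ => τ ++ [d τ]) m

theorem follow_succ (d : Str → Bool) (m : ℕ) (σ : Str) :
    follow d (m + 1) σ = follow d m σ ++ [d (follow d m σ)] := rfl

theorem length_follow (d : Str → Bool) (m : ℕ) (σ : Str) :
    (follow d m σ).length = σ.length + m := by
  induction m with
  | zero => rfl
  | succ m ih => rw [follow_succ, List.length_append, ih]; rfl

theorem follow_add (d : Str → Bool) (a b : ℕ) (σ : Str) :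
    follow d (a + b) σ = follow d b (follow d a σ) := by
  induction b with
  | zero => rfl
  | succ b ih => rw [← Nat.add_assoc, follow_succ, follow_succ, ih]

theorem prefix_follow (d : Str → Bool) (m : ℕ) (σ : Str) : σ <+: follow d m σ := by
  induction m with
  | zero => exact List.prefix_rfl
  | succ m ih => exact ih.trans (List.prefix_append _ _)

theorem eq_follow_of_prefix {d : Str → Bool} {m : ℕ} {σ τ : Str} (h1 : σ <+: τ)
    (h2 : τ <+: follow d m σ) : ∃ j, τ = follow d j σ := by
  have hl1 := h1.length_le
  have hl2 := h2.length_le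
  rw [length_follow] at hl2
  refine ⟨τ.length - σ.length, ?_⟩
  have h3 : follow d (τ.length - σ.length) σ <+: follow d m σ := by
    rw [show m = (τ.length - σ.length) + (m - (τ.length - σ.length)) by omega, follow_add]
    exact prefix_follow _ _ _
  refine (List.prefix_of_prefix_length_le h2 h3 ?_).eq_of_length ?_ <;>
  · rw [length_follow]; omega

theorem follow_congr {d d' : Str → Bool} {m : ℕ} {σ : Str}
    (h : ∀ τ : Str, τ.length < σ.length + m → d τ = d' τ) : follow d m σ = follow d' m σ := by
  induction m with
  | zero => rfl
  | succ m ih =>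
    rw [follow_succ, follow_succ, ih fun τ hτ => h τ (by omega), h]
    rw [length_follow]
    omega

/-- The choice function computed by the code `e` within `s` steps. -/
def codeChoice (e s : ℕ) (τ : Str) : Bool :=
  decide (Nat.Partrec.Code.evaln s (Denumerable.ofNat Nat.Partrec.Code e) (encode τ) = some 1)

/-- All extensions to length `3 * n` of strings of length `n` along choice functions with code
less than `n` that are computed within `s` steps. -/
def candidates (n s : ℕ) : List Str :=
  (List.range n).flatMap fun e => (allStr n).map fun σ => follow (codeChoice e s) (2 * n) σ

theorem computableIn_candidates {O : Set (ℕ →. ℕ)} {g : ℕ → ℕ} (hg : ComputableIn O g) :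
    ComputableIn O fun n => candidates n (g n) := by
  unfold candidates follow codeChoice
  fun_prop

/-- There are `n` codes and `2 ^ n` starting strings, each yielding a string of length `3 * n`, and
`n · 2ⁿ · 2⁻³ⁿ ≤ 2⁻ⁿ`. -/
theorem lebesgue_candidates (n s : ℕ) : lebesgue.real (cyl (candidates n s)) ≤ (1 / 2) ^ n := by
  have hlen : ∀ τ ∈ candidates n s, τ.length = 3 * n := by
    intro τ hτ
    simp only [candidates, List.mem_flatMap, List.mem_map, mem_allStr] at hτ
    obtain ⟨e, -, σ, hσ, rfl⟩ := hτ
    rw [length_follow, hσ]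
    omega
  have hcard : (candidates n s).length = n * 2 ^ n := by
    simp [candidates, List.length_flatMap, length_allStr]
  refine (lebesgue_cyl_le _ hlen).trans ?_
  have h1 : (n : ℝ) ≤ 2 ^ n := by exact_mod_cast Nat.lt_two_pow_self.le
  rw [hcard, pow_mul]
  push_cast
  calc (n : ℝ) * 2 ^ n * ((1 / 2) ^ 3) ^ n ≤ 2 ^ n * 2 ^ n * ((1 / 2) ^ 3) ^ n := by gcongr
    _ = (1 / 2) ^ n := by rw [← mul_pow, ← mul_pow]; norm_num

theorem exists_common_stage {α : Type} {P : ℕ → α → Prop}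
    (hP : ∀ s t a, s ≤ t → P s a → P t a) (l : List α) (h : ∀ a ∈ l, ∃ s, P s a) :
    ∃ s, ∀ a ∈ l, P s a := by
  induction l with
  | nil => simp
  | cons a l ih =>
    obtain ⟨s, hs⟩ := ih fun b hb => h b (List.mem_cons_of_mem _ hb)
    obtain ⟨t, ht⟩ := h a List.mem_cons_self
    refine ⟨max s t, fun b hb => ?_⟩
    rcases List.mem_cons.1 hb with rfl | hb
    · exact hP _ _ _ (le_max_right _ _) ht
    · exact hP _ _ _ (le_max_left _ _) (hs b hb)

/-- A time bound that no computable function dominates suffices infinitely often to evaluate a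
given computable choice function. -/
theorem exists_codeChoice {g : ℕ → ℕ}
    (hg : ∀ h : ℕ → ℕ, ComputableIn ∅ h → ∀ N, ∃ n, N ≤ n ∧ h n ≤ g n) {d : Str → Bool}
    (hd : ComputableIn ∅ d) (N : ℕ) :
    ∃ e n, N ≤ n ∧ e < n ∧ ∀ τ : Str, τ.length < 3 * n → codeChoice e (g n) τ = d τ := by
  have hd' : ComputableIn ∅ fun τ => (d τ).toNat := by fun_prop
  obtain ⟨c, hc⟩ := Nat.Partrec.Code.exists_code.1 (computableIn_empty_iff.1 hd')
  have hev : ∀ τ : Str, c.eval (encode τ) = Part.some (d τ).toNat := by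
    intro τ
    rw [hc]
    simp
  let P : ℕ → Str → Prop := fun s τ => (Nat.Partrec.Code.evaln s c (encode τ)).isSome = true
  -- The least such `s` is a computable function of `n`, so infinitely often `g n` is at least as
  -- large and suffices for all strings of length below `3 * n`.
  have hex : ∀ n, ∃ s, (((List.range (3 * n)).flatMap allStr).all fun τ =>
      (Nat.Partrec.Code.evaln s c (encode τ)).isSome) = true := by
    intro n
    simp only [List.all_eq_true]
    refine exists_common_stage (P := P) (fun s t τ hst => ?_) _ fun τ _ => ?_
    · simp only [P, Option.isSome_iff_exists]
      exact fun ⟨y, hy⟩ => ⟨y, Nat.Partrec.Code.evaln_mono hst hy⟩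
    · obtain ⟨s, hs⟩ := Nat.Partrec.Code.evaln_complete.1
        (show (d τ).toNat ∈ c.eval (encode τ) by rw [hev]; exact Part.mem_some _)
      exact ⟨s, Option.isSome_iff_exists.2 ⟨_, hs⟩⟩
  obtain ⟨n, hn, hle⟩ := hg _ (computableIn_find (P := fun n s =>
    ((List.range (3 * n)).flatMap allStr).all fun τ =>
      (Nat.Partrec.Code.evaln s c (encode τ)).isSome) (by fun_prop) hex) (max N (encode c + 1))
  refine ⟨encode c, n, by omega, by omega, fun τ hτ => ?_⟩
  have h1 := List.all_eq_true.1 (Nat.find_spec (hex n)) τ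
    (List.mem_flatMap.2 ⟨τ.length, List.mem_range.2 hτ, mem_allStr.2 rfl⟩)
  obtain ⟨y, hy⟩ := Option.isSome_iff_exists.1 h1
  have h2 := Nat.Partrec.Code.evaln_sound hy
  rw [hev, Part.mem_some_iff] at h2
  rw [codeChoice, Denumerable.ofNat_encode, Nat.Partrec.Code.evaln_mono hle hy, h2]
  cases d τ <;> simp

theorem countable_computableIn : {f : Str → ℕ | ComputableIn ∅ f}.Countable := by
  let raw : (Str → ℕ) → ℕ →. ℕ := fun f n =>
    Part.bind (decode (α := Str) n) fun a => (Part.some (f a)).map encode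
  have hinj : Function.Injective raw := by
    intro f g h
    funext a
    have := congrFun h (encode a)
    simpa [raw] using this
  have hc : (Set.range Nat.Partrec.Code.eval).Countable := Set.countable_range _
  refine (hc.preimage_of_injOn (f := raw) hinj.injOn).mono fun f hf => ?_
  exact Nat.Partrec.Code.exists_code.1 (computableIn_empty_iff.1 hf)

theorem countable_ratComputableIn : {M : Str → ℚ | RatComputableIn ∅ M}.Countable := by
  have h := (countable_computableIn.prod (countable_computableIn.prod countable_computableIn)).image
    fun p : (Str → ℕ) × (Str → ℕ) × (Str → ℕ) =>
      fun x => ((p.1 x : ℚ) - (p.2.1 x : ℚ)) / ((p.2.2 x : ℚ) + 1)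
  refine h.mono ?_
  rintro M ⟨a, b, c, ha, hb, hc, hM⟩
  exact ⟨(a, b, c), ⟨ha, hb, hc⟩, (funext hM).symm⟩

/-- A computable martingale without bound on the initial capital. -/
structure IsBetting (L : Str → ℚ) : Prop where
  nonneg : ∀ σ, 0 ≤ L σ
  fair : ∀ σ, L (σ ++ [false]) + L (σ ++ [true]) = 2 * L σ
  computable : RatComputableIn ∅ L

/-- The choice function that avoids gains of `L`. -/
def avoid (L : Str → ℚ) (τ : Str) : Bool := decide (L (τ ++ [true]) < L (τ ++ [false]))

theorem IsBetting.computableIn_avoid {L : Str → ℚ} (hL : IsBetting L) :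
    ComputableIn ∅ (avoid L) :=
  (hL.computable.comp (g := fun τ : Str => τ ++ [true]) (by fun_prop)).decide_lt
    (hL.computable.comp (g := fun τ : Str => τ ++ [false]) (by fun_prop))

theorem IsBetting.follow_avoid_le {L : Str → ℚ} (hL : IsBetting L) (m : ℕ) (σ : Str) :
    L (follow (avoid L) m σ) ≤ L σ := by
  induction m with
  | zero => exact le_rfl
  | succ m ih =>
    rw [follow_succ]
    refine le_trans ?_ ih
    generalize follow (avoid L) m σ = τ
    have hf := hL.fair τ
    by_cases h : L (τ ++ [true]) < L (τ ++ [false])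
    · simp only [avoid, h, decide_true]
      linarith
    · simp only [avoid, h, decide_false]
      linarith

/-- A small multiple of the new martingale `M` is added to the current one `L`, keeping the capital
at `σ` below `1`. The choice function avoiding gains of the sum is computable and keeps it below
`1`. For some large `n` the time bound `g n` suffices to evaluate that choice function, and
following it up to length `3 * n` ends in one of the candidates. -/
theorem exists_next {g : ℕ → ℕ}
    (hg : ∀ h : ℕ → ℕ, ComputableIn ∅ h → ∀ N, ∃ n, N ≤ n ∧ h n ≤ g n) {L M : Str → ℚ}
    (hL : IsBetting L) (hM : IsBetting M) {σ : Str} (hσ : L σ < 1) (k : ℕ) :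
    ∃ (σ' : Str) (L' : Str → ℚ), IsBetting L' ∧ σ <+: σ' ∧ σ.length < σ'.length ∧
      (∃ w : ℚ, 0 < w ∧ ∀ τ, w * M τ ≤ L' τ) ∧ (∀ τ, L τ ≤ L' τ) ∧
      (∀ τ, σ <+: τ → τ <+: σ' → L' τ < 1) ∧ ∃ n, k ≤ n ∧ σ' ∈ candidates n (g n) := by
  have hM0 := hM.nonneg σ
  -- The weight spends less than the remaining margin `1 - L σ`; the summand `1` covers the case `M
  -- σ = 0`.
  set w : ℚ := (1 - L σ) / (2 * (M σ + 1)) with hw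
  have hwpos : 0 < w := div_pos (by linarith) (by linarith)
  have hwM : w * M σ < 1 - L σ := by
    rw [hw, div_mul_eq_mul_div, div_lt_iff₀ (by linarith)]
    nlinarith
  have hL' : IsBetting fun τ => L τ + w * M τ := by
    refine ⟨fun τ => add_nonneg (hL.nonneg τ) (mul_nonneg hwpos.le (hM.nonneg τ)), fun τ => ?_,
      hL.computable.add ((RatComputableIn.const w).mul hM.computable)⟩
    linear_combination hL.fair τ + w * hM.fair τ
  set L' : Str → ℚ := fun τ => L τ + w * M τ with hL'def
  obtain ⟨e, n, hn, he, hcode⟩ := exists_codeChoice hg hL'.computableIn_avoid (k + σ.length + 1)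
  -- The bits up to length `n` produce one of the starting strings; the remaining `2 * n` bits are
  -- those the candidates reproduce.
  refine ⟨follow (avoid L') (n - σ.length + 2 * n) σ, L', hL', prefix_follow _ _ _, ?_,
    ⟨w, hwpos, fun τ => ?_⟩, fun τ => ?_, fun τ h1 h2 => ?_, n, by omega, ?_⟩
  · rw [length_follow]; omega
  · have := hL.nonneg τ
    simp only [hL'def]
    linarith
  · have := mul_nonneg hwpos.le (hM.nonneg τ)
    simp only [hL'def]
    linarith
  · obtain ⟨j, rfl⟩ := eq_follow_of_prefix h1 h2
    refine (hL'.follow_avoid_le j σ).trans_lt ?_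
    simp only [hL'def]
    linarith
  · have hlen : (follow (avoid L') (n - σ.length) σ).length = n := by
      rw [length_follow]; omega
    rw [follow_add]
    refine List.mem_flatMap.2 ⟨e, List.mem_range.2 he, List.mem_map.2
      ⟨_, mem_allStr.2 hlen, follow_congr fun τ hτ => hcode τ ?_⟩⟩
    rw [hlen] at hτ
    omega

/-- A function computable in `A` that no computable function dominates yields a computably random
real that is not Schnorr random relative to `A`. -/
theorem exists_CR_notMem_SR {A : BinSeq} {g : ℕ → ℕ} (hgA : ComputableIn {toOracle A} g)
    (hg : ∀ h : ℕ → ℕ, ComputableIn ∅ h → ∀ N, ∃ n, N ≤ n ∧ h n ≤ g n) :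
    ∃ Z, Z ∈ CR ∅ ∧ Z ∉ SR {toOracle A} := by
  have hzero : IsBetting fun _ => 0 :=
    ⟨fun _ => le_rfl, fun _ => by simp, RatComputableIn.const 0⟩
  -- Countability alone is used here: the list of martingales, and the real built from it, need not
  -- be computable.
  obtain ⟨M, hM⟩ := (countable_ratComputableIn.mono
    (fun L (hL : IsBetting L) => hL.computable)).exists_eq_range ⟨_, hzero⟩
  have hMb : ∀ i, IsBetting (M i) := fun i => by
    have : M i ∈ {L | IsBetting L} := hM ▸ Set.mem_range_self i
    exact this
  choose nextσ nextL hb hpre hlen hdom hmono hlt hcand using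
    fun (k : ℕ) (s : {p : Str × (Str → ℚ) // IsBetting p.2 ∧ p.2 p.1 < 1}) =>
      exists_next hg s.2.1 (hMb k) s.2.2 k
  let State := {p : Str × (Str → ℚ) // IsBetting p.2 ∧ p.2 p.1 < 1}
  let next : ℕ → State → State := fun k s =>
    ⟨(nextσ k s, nextL k s), hb k s, hlt k s _ (hpre k s) List.prefix_rfl⟩
  let s : ℕ → State := fun n =>
    Nat.rec (motive := fun _ => State) ⟨([], fun _ => 0), hzero, by norm_num⟩ next n
  obtain ⟨hle, Z, hZ⟩ := exists_limit (σ := fun n => (s n).1.1) (fun n => hpre n (s n))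
    (fun n => hlen n (s n))
  refine ⟨Z, fun N hN hNc hs => ?_, ?_⟩
  · obtain ⟨i, rfl⟩ : N ∈ Set.range M := hM ▸ (⟨hN.nonneg, hN.fair, hNc⟩ : IsBetting N)
    obtain ⟨w, hw, hwM⟩ := hdom i (s i)
    have hLmono : ∀ j τ, w * M i τ ≤ (s (i + 1 + j)).1.2 τ := by
      intro j τ
      induction j with
      | zero => exact hwM τ
      | succ j ih => exact ih.trans (hmono (i + 1 + j) (s (i + 1 + j)) τ)
    -- Each later segment keeps its own combined martingale below `1`, and that martingale dominates
    -- `w * M i`. So `M i` stays below `1 / w` on all prefixes of `Z` extending the string reached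
    -- at step `i`.
    have hbound : ∀ j τ, (s i).1.1 <+: τ → τ <+: (s (i + 1 + j)).1.1 → w * M i τ < 1 := by
      intro j
      induction j with
      | zero => exact fun τ h1 h2 => (hwM τ).trans_lt (hlt i (s i) τ h1 h2)
      | succ j ih =>
        intro τ h1 h2
        rcases List.prefix_or_prefix_of_prefix h2 (hpre (i + 1 + j) (s (i + 1 + j))) with h | h
        · exact ih τ h1 h
        · exact (hLmono (j + 1) τ).trans_lt (hlt (i + 1 + j) (s (i + 1 + j)) τ h h2)
    obtain ⟨m, hm, hmlen⟩ := ((hs (1 / w)).and_eventually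
      (eventually_ge_atTop (s i).1.1.length)).exists
    have h1 : (s i).1.1 <+: restrict Z m := (mem_basicOpen_iff_prefix hmlen).1 (hZ i)
    have h2 : restrict Z m <+: (s (i + 1 + m)).1.1 := by
      rw [← mem_basicOpen.1 (hZ (i + 1 + m))]
      exact restrict_prefix Z ((by omega : m ≤ i + 1 + m).trans (hle _))
    have h3 := hbound m _ h1 h2
    rw [div_lt_iff₀ hw] at hm
    linarith
  · refine notMem_SR_of_clopen (f := fun n => candidates n (g n)) (computableIn_candidates hgA)
      (fun n => lebesgue_candidates n (g n)) (frequently_atTop.2 fun k => ?_)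
    obtain ⟨n, hn, hmem⟩ := hcand k (s k)
    exact ⟨n, hn, _, hmem, hZ (k + 1)⟩

/-- A function computable from `A` without a computable bound would produce, through
`exists_CR_notMem_SR`, a real contradicting lowness. -/
theorem hyperimmuneFree_of_low_CR_SR {A : BinSeq} (hA : A ∈ Low CR SR) : HyperimmuneFree A := by
  intro g hgA
  by_contra! hcon
  obtain ⟨Z, hZ, hZA⟩ := exists_CR_notMem_SR hgA fun h hh N => by
    -- Adding the constant `∑ i < N, g i` to `h` forces the argument where `g` exceeds the sum to be
    -- at least `N`, which turns one escape into infinitely many.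
    obtain ⟨n, hn⟩ := hcon (fun n => h n + ∑ i ∈ Finset.range N, g i)
      (computableIn_empty_iff.1 (by fun_prop))
    refine ⟨n, ?_, by omega⟩
    by_contra! hlt
    have : g n ≤ ∑ i ∈ Finset.range N, g i :=
      Finset.single_le_sum (f := g) (fun _ _ => Nat.zero_le _) (Finset.mem_range.2 hlt)
    omega
  exact hZA (hA hZ)

end Lowness

/-! ### The equivalences -/

theorem theorem3p1 (A : Lowness.BinSeq) :
    (A ∈ Lowness.Low Lowness.MR Lowness.SR ↔ Lowness.RETraceable A) ∧
      (A ∈ Lowness.Low Lowness.CR Lowness.SR ↔ A ∈ Lowness.Low Lowness.SR Lowness.SR) ∧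
      (A ∈ Lowness.Low Lowness.SR Lowness.SR ↔ Lowness.ComputablyTraceable A) := by
  have h1 : A ∈ Lowness.Low Lowness.CR Lowness.SR → Lowness.ComputablyTraceable A := fun h =>
    Lowness.computablyTraceable_of_reTraceable
      (Lowness.reTraceable_of_low_MR_SR
        ((Lowness.MR_subset_CR Lowness.totalOracles_empty).trans h))
      (Lowness.hyperimmuneFree_of_low_CR_SR h)
  have h2 : A ∈ Lowness.Low Lowness.SR Lowness.SR → A ∈ Lowness.Low Lowness.CR Lowness.SR :=
    fun h => (Lowness.CR_subset_SR Lowness.totalOracles_empty).trans h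
  have h3 : Lowness.ComputablyTraceable A → A ∈ Lowness.Low Lowness.SR Lowness.SR :=
    Lowness.low_SR_SR_of_computablyTraceable
  exact ⟨⟨Lowness.reTraceable_of_low_MR_SR, Lowness.low_MR_SR_of_reTraceable⟩,
    ⟨fun h => h3 (h1 h), h2⟩, fun h => h1 (h2 h), h3⟩
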